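/- **Setting.** Let $n,k\ge 1$. The inputs are sets $\vec S=(S_1,\dots,S_k)$ with $S_j\subseteq[n]$, a set $T\subseteq[n]$ and an index $i\in[k]$; the task $\mathrm{SEL}_k^{\mathsf{DISJ}_n}$ is to decide whether $S_i\cap T=\emptyset$. All protocols are deterministic and make no error, and messages are finite bit strings, with $|\cdot|$ denoting their length. In a *modified 4-party number-on-forehead protocol* Charlie knows $\vec S,T$; Megan knows $\vec S,i$; Alice knows $S_i,i$; Bob knows $T,i$. (1) Charlie sends a message $U=U(\vec S,T)$ privately to Bob. (2) Charlie sends a message $U'=U'(\vec S,T)$ to Megan. (3) Megan broadcasts a message $\Pi_i^{\mathcal M}=\Pi_i^{\mathcal M}(\vec S,i,U')$ to Alice and Bob. (4) Alice (holding $S_i,i,\Pi_i^{\mathcal M}$) and Bob (holding $T,i,U,\Pi_i^{\mathcal M}$) exchange bits in the standard two-party model, with any number of rounds, producing a transcript $\Pi_i^{A\leftrightarrow B}$, after which one of them gives the answer. Write $\Pi_i=(U',\Pi_i^{\mathcal M},\Pi_i^{A\leftrightarrow B})$ and let $|\Pi_i|$ be the largest total number of bits of these three parts over all inputs $\vec S,T$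 with index $i$. In a *1.5-round protocol* Charlie knows $\vec S,T$; Alice knows $\vec S,i$; Bob knows $T,i$. Charlie sends $U(\vec S,T)$ privately to Bob; Bob sends to Alice a message $U'$ that depends only on $U$ and $T$ (not on $i$); Alice sends to Bob a message $\Pi_i^{A\to B}$ depending on $\vec S,i,U'$; Bob gives the answer from $T,i,U$ and $\Pi_i^{A\to B}$. **Theorem.** There are absolute constants $c,\delta>0$ such that the following holds for all $n\ge 1$ and all $k$ with $n\le\delta k$. 1. For every modified 4-party protocol that solves $\mathrm{SEL}_k^{\mathsf{DISJ}_n}$ and in which always $|U|\le\delta k$, there is an index $i\in[k]$ with $|\Pi_i|\ge c\sqrt n$. 2. For every 1.5-round protocol that solves $\mathrm{SEL}_k^{\mathsf{DISJ}_n}$ and in which always $|U|\le\delta k$, there are $i\in[k]$, $\vec S$ and $T$ with $|U'|+|\Pi_i^{A\to B}|\ge c\sqrt n$. In particular, if $k=\omega(n)$ and $|U|=o(k)$, then $\max_{i\in[k]}|\Pi_i|=\Omega(\sqrt n)$ for modified 4-party protocols, and $\max\,(|U'|+|\Pi_i^{A\to B}|)=\Omega(\sqrt n)$ for 1.5-round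 protocols. -/

import Mathlib

namespace Multiphase

/-- A set in `[n]`. -/
abbrev Subset (n : ℕ) : Type := Finset (Fin n)

/-- The collection `S₁, …, S_k` of subsets of `[n]`. -/
abbrev Family (n k : ℕ) : Type := Fin k → Subset n

/-- A message: a finite string of bits; its size is its length. -/
abbrev Message : Type := List Bool

/-- A deterministic two-party protocol tree for players holding `x : X` (Alice) and `y : Y` (Bob).
At an inner node the named player sends the next bit, a function of that player's input (the
dependence on the earlier bits is the position in the tree). At a leaf one of the two players
gives the answer, computed from that player's input and from the transcript. -/
inductive TwoParty (X Y : Type) : Type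
  | aliceAnswers (out : X → Bool) : TwoParty X Y
  | bobAnswers (out : Y → Bool) : TwoParty X Y
  | aliceSends (bit : X → Bool) (next : Bool → TwoParty X Y) : TwoParty X Y
  | bobSends (bit : Y → Bool) (next : Bool → TwoParty X Y) : TwoParty X Y

namespace TwoParty

variable {X Y : Type}

/-- The bits exchanged on the inputs `x` and `y`. -/
def transcript : TwoParty X Y → X → Y → Message
  | aliceAnswers _, _, _ => []
  | bobAnswers _, _, _ => []
  | aliceSends bit next, x, y => bit x :: (next (bit x)).transcript x y
  | bobSends bit next, x, y => bit y :: (next (bit y)).transcript x y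

/-- The answer given on the inputs `x` and `y`. -/
def answer : TwoParty X Y → X → Y → Bool
  | aliceAnswers out, x, _ => out x
  | bobAnswers out, _, y => out y
  | aliceSends bit next, x, y => (next (bit x)).answer x y
  | bobSends bit next, x, y => (next (bit y)).answer x y

end TwoParty

/-- A modified 4-party number-on-forehead protocol for inputs `S₁, …, S_k ⊆ [n]`, `T ⊆ [n]` and
an index `i ∈ [k]`. Charlie knows all `S_j` and `T`, Megan knows all `S_j` and `i`, Alice knows
`S_i` and `i`, and Bob knows `T` and `i`. -/
structure ModifiedProtocol (n k : ℕ) where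
  /-- `U(S, T)`, sent by Charlie privately to Bob. -/
  advice : Family n k → Subset n → Message
  /-- `U'(S, T)`, sent by Charlie to Megan. -/
  hint : Family n k → Subset n → Message
  /-- Megan's broadcast to Alice and Bob, a function of `S`, `i` and `U'`. -/
  megan : Family n k → Fin k → Message → Message
  /-- The conversation of Alice, who holds `S_i`, and Bob, who holds `T` and `U`. Both know `i` and
  Megan's message, so the tree depends on these. -/
  talk : Fin k → Message → TwoParty (Subset n) (Subset n × Message)

namespace ModifiedProtocol

variable {n k : ℕ}

/-- Megan's message on the inputs `S`, `T`, `i`. -/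
def meganMessage (Γ : ModifiedProtocol n k) (S : Family n k) (T : Subset n) (i : Fin k) : Message :=
  Γ.megan S i (Γ.hint S T)

/-- The bits exchanged between Alice and Bob on the inputs `S`, `T`, `i`. -/
def talkTranscript (Γ : ModifiedProtocol n k) (S : Family n k) (T : Subset n) (i : Fin k) :
    Message :=
  (Γ.talk i (Γ.meganMessage S T i)).transcript (S i) (T, Γ.advice S T)

/-- The answer of the protocol on the inputs `S`, `T`, `i`. -/
def answer (Γ : ModifiedProtocol n k) (S : Family n k) (T : Subset n) (i : Fin k) : Bool :=
  (Γ.talk i (Γ.meganMessage S T i)).answer (S i) (T, Γ.advice S T)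

/-- The number of bits of `Π_i = (U', Megan's message, conversation of Alice and Bob)`. -/
def cost (Γ : ModifiedProtocol n k) (S : Family n k) (T : Subset n) (i : Fin k) : ℕ :=
  (Γ.hint S T).length + (Γ.meganMessage S T i).length + (Γ.talkTranscript S T i).length

/-- The protocol decides, without error, whether `S_i` and `T` are disjoint. -/
def Solves (Γ : ModifiedProtocol n k) : Prop :=
  ∀ (S : Family n k) (T : Subset n) (i : Fin k), Γ.answer S T i = true ↔ Disjoint (S i) T

end ModifiedProtocol

/-- A 1.5-round protocol. Charlie knows all `S_j` and `T`, Alice knows all `S_j` and `i`, and Bob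
knows `T` and `i`, but Bob's only message is independent of `i`. -/
structure OneAndHalfRoundProtocol (n k : ℕ) where
  /-- `U(S, T)`, sent by Charlie privately to Bob. -/
  advice : Family n k → Subset n → Message
  /-- `U'`, sent by Bob to Alice; a function of `T` and `U`, but not of `i`. -/
  forward : Subset n → Message → Message
  /-- Alice's message to Bob, a function of `S`, `i` and `U'`. -/
  alice : Family n k → Fin k → Message → Message
  /-- Bob's answer, a function of `T`, `i`, `U` and Alice's message. -/
  output : Subset n → Fin k → Message → Message → Bool

namespace OneAndHalfRoundProtocol

variable {n k : ℕ}

/-- Bob's message to Alice on the inputs `S`, `T`. -/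
def forwarded (Γ : OneAndHalfRoundProtocol n k) (S : Family n k) (T : Subset n) : Message :=
  Γ.forward T (Γ.advice S T)

/-- Alice's message to Bob on the inputs `S`, `T`, `i`. -/
def aliceMessage (Γ : OneAndHalfRoundProtocol n k) (S : Family n k) (T : Subset n) (i : Fin k) :
    Message :=
  Γ.alice S i (Γ.forwarded S T)

/-- The number of bits that Alice and Bob exchange. -/
def cost (Γ : OneAndHalfRoundProtocol n k) (S : Family n k) (T : Subset n) (i : Fin k) : ℕ :=
  (Γ.forwarded S T).length + (Γ.aliceMessage S T i).length

/-- The protocol decides, without error, whether `S_i` and `T` are disjoint. -/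
def Solves (Γ : OneAndHalfRoundProtocol n k) : Prop :=
  ∀ (S : Family n k) (T : Subset n) (i : Fin k),
    Γ.output T i (Γ.advice S T) (Γ.aliceMessage S T i) = true ↔ Disjoint (S i) T

end OneAndHalfRoundProtocol

end Multiphase

/-! Put `s = ⌊√n⌋` and draw each set by choosing at most one element, uniformly, in each of `s`
blocks of size `s`; two such sets are disjoint with probability at least 1/3. Suppose that `S_i` and
`T` have nearly full entropy given a conversation whose answer is "disjoint". The two choices then
never agree on an element of a block, whereas independent nearly uniform choices would do so with
probability about `1 / s`. So every block contributes mutual information of order `1 / s`, and all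
blocks together a constant (`mutualInfo_ge_of_no_collision`, `mutualInfo_ge_of_disjoint`).

A two-party conversation cannot create this information (`TwoParty.mutualInfo_outcome_le`), so `S_i`
must already share it with Bob's view `(T, U)` given the hint and Megan's message. For a single `T`
it could come from the advice `U` and the hint. Hence one takes `s` samples `T_j`, independent given
`S` and the hint (`Copies`); all of them see the same hint and the same message of Megan. The views
of Bob have total entropy about `s (n + |U|)` at most, up to a constant. Spread over `k` independent
sets this costs an average `S_i` only a small fraction of `s`. By the chain rule, all `s` views
together carry at most this loss plus the short messages about `S_i`, and an average view a fraction
`1 / s` of that: a small constant, unless the messages have order `s` bits.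
`ModifiedProtocol.large_cost` carries out this averaging.

For bounded `n` it is enough to exclude cost zero, by counting advice strings
(`ModifiedProtocol.exists_cost_pos`). A 1.5-round protocol is a modified protocol with an empty
conversation. -/

namespace Multiphase

open Finset

/-! ### Entropy of partitions; random variables enter as kernels and joint variables as infima. -/

section Entropy

open scoped Classical in
/-- The probability of the class of `ω` in the partition `r`. -/
noncomputable def mass {Ω : Type} [Fintype Ω] (p : Ω → ℝ) (r : Setoid Ω) (ω : Ω) : ℝ :=
  ∑ ω', if r ω ω' then p ω' else 0

open scoped Classical in
/-- The conditional expectation of `g` with respect to the partition `r`. -/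
noncomputable def condAvg {Ω : Type} [Fintype Ω] (p : Ω → ℝ) (r : Setoid Ω) (g : Ω → ℝ) (ω : Ω) :
    ℝ :=
  (∑ ω', if r ω ω' then p ω' * g ω' else 0) / mass p r ω

/-- The Shannon entropy (in nats) of the partition `r`. -/
noncomputable def entropy {Ω : Type} [Fintype Ω] (p : Ω → ℝ) (r : Setoid Ω) : ℝ :=
  -∑ ω, p ω * Real.log (mass p r ω)

/-- The mutual information of `A` and `B` conditioned on `C`. -/
noncomputable def mutualInfo {Ω : Type} [Fintype Ω] (p : Ω → ℝ) (A B C : Setoid Ω) : ℝ :=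
  entropy p (A ⊓ C) + entropy p (B ⊓ C) - entropy p (A ⊓ B ⊓ C) - entropy p C

variable {Ω : Type} [Fintype Ω] {p : Ω → ℝ}

lemma mass_congr {r : Setoid Ω} {ω ω' : Ω} (h : r ω ω') : mass p r ω = mass p r ω' := by
  classical
  unfold mass
  refine Finset.sum_congr rfl fun x _ => ?_
  have : r ω x ↔ r ω' x := ⟨fun hx => r.trans' (r.symm' h) hx, fun hx => r.trans' h hx⟩
  simp only [this]

lemma mass_pos (hp : ∀ ω, 0 < p ω) (r : Setoid Ω) (ω : Ω) : 0 < mass p r ω := by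
  classical
  unfold mass
  refine Finset.sum_pos' (fun x _ => ?_) ⟨ω, Finset.mem_univ _, ?_⟩
  · split_ifs
    exacts [(hp x).le, le_rfl]
  · rw [if_pos (r.refl' ω)]
    exact hp ω

lemma mass_mono (hp : ∀ ω, 0 < p ω) {r r' : Setoid Ω} (h : r ≤ r') (ω : Ω) :
    mass p r ω ≤ mass p r' ω := by
  classical
  unfold mass
  refine Finset.sum_le_sum fun x _ => ?_
  by_cases hx : r ω x
  · rw [if_pos hx, if_pos (h hx)]
  · rw [if_neg hx]
    split_ifs
    exacts [(hp x).le, le_rfl]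

lemma mass_top (hs : ∑ ω, p ω = 1) (ω : Ω) : mass p ⊤ ω = 1 := by
  classical
  unfold mass
  rw [← hs]
  exact Finset.sum_congr rfl fun x _ => if_pos trivial

lemma entropy_top (hs : ∑ ω, p ω = 1) : entropy p ⊤ = 0 := by
  simp [entropy, mass_top hs]

lemma entropy_mono (hp : ∀ ω, 0 < p ω) {r r' : Setoid Ω} (h : r ≤ r') :
    entropy p r' ≤ entropy p r := by
  unfold entropy
  refine neg_le_neg (Finset.sum_le_sum fun ω _ => ?_)
  exact mul_le_mul_of_nonneg_left (Real.log_le_log (mass_pos hp r ω) (mass_mono hp h ω)) (hp ω).le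

lemma condAvg_congr {r : Setoid Ω} {g : Ω → ℝ} {ω ω' : Ω} (h : r ω ω') :
    condAvg p r g ω = condAvg p r g ω' := by
  classical
  unfold condAvg
  rw [mass_congr h]
  congr 1
  refine Finset.sum_congr rfl fun x _ => ?_
  have : r ω x ↔ r ω' x := ⟨fun hx => r.trans' (r.symm' h) hx, fun hx => r.trans' h hx⟩
  simp only [this]

lemma condAvg_nonneg (hp : ∀ ω, 0 < p ω) {r : Setoid Ω} {g : Ω → ℝ} (hg : ∀ ω, 0 ≤ g ω) (ω : Ω) :
    0 ≤ condAvg p r g ω := by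
  classical
  unfold condAvg
  refine div_nonneg (Finset.sum_nonneg fun x _ => ?_) (mass_pos hp r ω).le
  split_ifs
  exacts [mul_nonneg (hp x).le (hg x), le_rfl]

/-- The tower property. -/
lemma sum_mul_condAvg (hp : ∀ ω, 0 < p ω) (r : Setoid Ω) (f g : Ω → ℝ)
    (hf : ∀ ω ω', r ω ω' → f ω = f ω') :
    ∑ ω, p ω * (f ω * condAvg p r g ω) = ∑ ω, p ω * (f ω * g ω) := by
  classical
  have h1 : ∀ ω, p ω * (f ω * condAvg p r g ω)
      = ∑ ω', if r ω ω' then p ω' * (f ω' * g ω') * (p ω / mass p r ω') else 0 := by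
    intro ω
    unfold condAvg
    rw [Finset.sum_div, Finset.mul_sum, Finset.mul_sum]
    refine Finset.sum_congr rfl fun x _ => ?_
    by_cases hx : r ω x
    · rw [if_pos hx, if_pos hx, hf ω x hx, mass_congr hx]
      ring
    · simp [if_neg hx]
  simp_rw [h1]
  rw [Finset.sum_comm]
  refine Finset.sum_congr rfl fun x _ => ?_
  have h2 : ∀ ω, (if r ω x then p x * (f x * g x) * (p ω / mass p r x) else 0)
      = p x * (f x * g x) / mass p r x * (if r x ω then p ω else 0) := by
    intro ω
    have : r ω x ↔ r x ω := ⟨fun h => r.symm' h, fun h => r.symm' h⟩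
    by_cases hx : r x ω
    · rw [if_pos hx, if_pos (this.2 hx)]; ring
    · rw [if_neg hx, if_neg (fun h => hx (this.1 h))]; ring
  simp_rw [h2]
  rw [← Finset.mul_sum]
  change _ / mass p r x * mass p r x = _
  rw [div_mul_cancel₀ _ (mass_pos hp r x).ne']

open scoped Classical in
/-- Replacing the joint law of `A` and `B` given `C` by the product of the conditional laws gives a
subprobability, which does not charge the pairs outside of `E` if `E` contains the support. -/
lemma sum_decoupled_le (hp : ∀ ω, 0 < p ω) (A B C : Setoid Ω) (θ : Ω → ℝ)
    (hθ : ∀ ω, 0 ≤ θ ω) (hθC : ∀ ω ω', C ω ω' → θ ω = θ ω') (E : Ω → Ω → Prop)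
    (hE : ∀ ω ω₁ ω₂, (A ⊓ C) ω ω₁ → (B ⊓ C) ω ω₂ → E ω₁ ω₂) :
    ∑ ω, p ω * (θ ω * (mass p (A ⊓ C) ω * mass p (B ⊓ C) ω
        / (mass p (A ⊓ B ⊓ C) ω * mass p C ω)))
      ≤ ∑ ω, p ω * (θ ω * ((∑ ω', if C ω ω' ∧ E ω ω' then p ω' else 0) / mass p C ω)) := by
  -- The mass ratio is the density of the decoupled law relative to the joint law; it expands over
  -- pairs `(ω₁, ω₂)`.
  have hL : ∀ ω, p ω * (θ ω * (mass p (A ⊓ C) ω * mass p (B ⊓ C) ω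
        / (mass p (A ⊓ B ⊓ C) ω * mass p C ω)))
      = ∑ ω₁, ∑ ω₂, if (A ⊓ C) ω ω₁ ∧ (B ⊓ C) ω ω₂ then
          p ω₁ * p ω₂ * (p ω * θ ω / (mass p (A ⊓ B ⊓ C) ω * mass p C ω)) else 0 := by
    intro ω
    have : mass p (A ⊓ C) ω * mass p (B ⊓ C) ω
        = ∑ ω₁, ∑ ω₂, if (A ⊓ C) ω ω₁ ∧ (B ⊓ C) ω ω₂ then p ω₁ * p ω₂ else 0 := by
      simp only [mass]
      rw [Finset.sum_mul_sum]
      refine Finset.sum_congr rfl fun x _ => Finset.sum_congr rfl fun y _ => ?_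
      by_cases h1 : (A ⊓ C) ω x <;> by_cases h2 : (B ⊓ C) ω y <;> simp [h1, h2]
    calc _ = (mass p (A ⊓ C) ω * mass p (B ⊓ C) ω)
          * (p ω * θ ω / (mass p (A ⊓ B ⊓ C) ω * mass p C ω)) := by ring
      _ = _ := by
        rw [this, Finset.sum_mul]
        refine Finset.sum_congr rfl fun x _ => ?_
        rw [Finset.sum_mul]
        refine Finset.sum_congr rfl fun y _ => ?_
        split_ifs <;> ring
  have hR : ∀ ω₁, p ω₁ * (θ ω₁ * ((∑ ω', if C ω₁ ω' ∧ E ω₁ ω' then p ω' else 0) / mass p C ω₁))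
      = ∑ ω₂, if C ω₁ ω₂ ∧ E ω₁ ω₂ then p ω₁ * p ω₂ * (θ ω₁ / mass p C ω₁) else 0 := by
    intro ω₁
    rw [Finset.sum_div, Finset.mul_sum, Finset.mul_sum]
    refine Finset.sum_congr rfl fun y _ => ?_
    split_ifs <;> ring
  simp_rw [hL, hR]
  rw [Finset.sum_comm]
  refine Finset.sum_le_sum fun ω₁ _ => ?_
  rw [Finset.sum_comm]
  refine Finset.sum_le_sum fun ω₂ _ => ?_
  -- For a fixed pair, the contributing `ω` form either the empty set or one class of `A ⊓ B ⊓ C`,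
  -- whose mass cancels the denominator.
  by_cases hex : ∃ ω₀, (A ⊓ C) ω₀ ω₁ ∧ (B ⊓ C) ω₀ ω₂
  · obtain ⟨ω₀, hA, hB⟩ := hex
    have hC : C ω₁ ω₂ := C.trans' (C.symm' hA.2) hB.2
    rw [if_pos ⟨hC, hE ω₀ ω₁ ω₂ hA hB⟩]
    have h1 : ∀ ω, (if (A ⊓ C) ω ω₁ ∧ (B ⊓ C) ω ω₂ then
          p ω₁ * p ω₂ * (p ω * θ ω / (mass p (A ⊓ B ⊓ C) ω * mass p C ω)) else 0)
        = p ω₁ * p ω₂ * (θ ω₁ / mass p C ω₁) / mass p (A ⊓ B ⊓ C) ω₀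
          * (if (A ⊓ B ⊓ C) ω₀ ω then p ω else 0) := by
      intro ω
      by_cases h : (A ⊓ C) ω ω₁ ∧ (B ⊓ C) ω ω₂
      · have h' : (A ⊓ B ⊓ C) ω₀ ω :=
          ⟨⟨A.trans' hA.1 (A.symm' h.1.1), B.trans' hB.1 (B.symm' h.2.1)⟩,
            C.trans' hA.2 (C.symm' h.1.2)⟩
        rw [if_pos h, if_pos h', mass_congr h', mass_congr h.1.2, hθC ω ω₁ h.1.2]
        have := (mass_pos hp C ω₁).ne'
        have := (mass_pos hp (A ⊓ B ⊓ C) ω).ne'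
        field_simp
      · have h' : ¬ (A ⊓ B ⊓ C) ω₀ ω := by
          intro h'
          exact h ⟨⟨A.trans' (A.symm' h'.1.1) hA.1, C.trans' (C.symm' h'.2) hA.2⟩,
            ⟨B.trans' (B.symm' h'.1.2) hB.1, C.trans' (C.symm' h'.2) hB.2⟩⟩
        rw [if_neg h, if_neg h', mul_zero]
    simp_rw [h1]
    rw [← Finset.mul_sum]
    change _ / mass p (A ⊓ B ⊓ C) ω₀ * mass p (A ⊓ B ⊓ C) ω₀ ≤ _
    rw [div_mul_cancel₀ _ (mass_pos hp _ _).ne']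
  · push Not at hex
    rw [Finset.sum_eq_zero fun ω _ => if_neg fun h => hex ω h.1 h.2]
    split_ifs
    · exact mul_nonneg (mul_nonneg (hp _).le (hp _).le)
        (div_nonneg (hθ _) (mass_pos hp _ _).le)
    · exact le_rfl

/-- The Gibbs inequality for the mutual information. -/
lemma sum_mul_le_mutualInfo (hp : ∀ ω, 0 < p ω) (hs : ∑ ω, p ω = 1) (A B C : Setoid Ω)
    (κ : Ω → ℝ)
    (h : ∑ ω, p ω * (Real.exp (κ ω) * (mass p (A ⊓ C) ω * mass p (B ⊓ C) ω
        / (mass p (A ⊓ B ⊓ C) ω * mass p C ω))) ≤ 1) :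
    ∑ ω, p ω * κ ω ≤ mutualInfo p A B C := by
  have key : ∀ ω, p ω * κ ω - p ω * (Real.log (mass p (A ⊓ B ⊓ C) ω) + Real.log (mass p C ω)
        - Real.log (mass p (A ⊓ C) ω) - Real.log (mass p (B ⊓ C) ω))
      ≤ p ω * (Real.exp (κ ω) * (mass p (A ⊓ C) ω * mass p (B ⊓ C) ω
        / (mass p (A ⊓ B ⊓ C) ω * mass p C ω))) - p ω := by
    intro ω
    have m1 := mass_pos hp (A ⊓ C) ω
    have m2 := mass_pos hp (B ⊓ C) ω
    have m3 := mass_pos hp (A ⊓ B ⊓ C) ω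
    have m4 := mass_pos hp C ω
    have hx : 0 < Real.exp (κ ω) * (mass p (A ⊓ C) ω * mass p (B ⊓ C) ω
        / (mass p (A ⊓ B ⊓ C) ω * mass p C ω)) := by positivity
    -- Here `log x ≤ x - 1` is used at the density ratio tilted by `exp κ`; after averaging, the
    -- right side is at most zero by `h`.
    have hl := Real.log_le_sub_one_of_pos hx
    rw [Real.log_mul (by positivity) (by positivity), Real.log_exp,
      Real.log_div (by positivity) (by positivity), Real.log_mul m1.ne' m2.ne',
      Real.log_mul m3.ne' m4.ne'] at hl
    nlinarith [mul_le_mul_of_nonneg_left hl (hp ω).le]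
  have hsum := Finset.sum_le_sum fun ω (_ : ω ∈ Finset.univ) => key ω
  rw [Finset.sum_sub_distrib, Finset.sum_sub_distrib, hs] at hsum
  have hI : ∑ ω, p ω * (Real.log (mass p (A ⊓ B ⊓ C) ω) + Real.log (mass p C ω)
        - Real.log (mass p (A ⊓ C) ω) - Real.log (mass p (B ⊓ C) ω)) = mutualInfo p A B C := by
    simp only [mutualInfo, entropy, mul_sub, mul_add, Finset.sum_sub_distrib,
      Finset.sum_add_distrib]
    ring
  linarith

/-- Submodularity of the entropy. -/
lemma mutualInfo_nonneg (hp : ∀ ω, 0 < p ω) (hs : ∑ ω, p ω = 1) (A B C : Setoid Ω) :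
    0 ≤ mutualInfo p A B C := by
  classical
  have h := sum_mul_le_mutualInfo hp hs A B C (fun _ => 0) ?_
  · simpa using h
  · simp only [Real.exp_zero]
    refine (sum_decoupled_le hp A B C (fun _ => 1) (fun _ => zero_le_one) (fun _ _ _ => rfl)
      (fun _ _ => True) (fun _ _ _ _ _ => trivial)).trans ?_
    simp only [and_true]
    refine (Finset.sum_le_sum fun ω _ => ?_).trans hs.le
    change p ω * (1 * (mass p C ω / mass p C ω)) ≤ _
    rw [div_self (mass_pos hp C ω).ne']
    simp

/-- Conditioning on more decreases the conditional entropy. -/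
lemma entropy_submodular (hp : ∀ ω, 0 < p ω) (hs : ∑ ω, p ω = 1) (A B C : Setoid Ω) :
    entropy p (A ⊓ B ⊓ C) + entropy p C ≤ entropy p (A ⊓ C) + entropy p (B ⊓ C) := by
  have := mutualInfo_nonneg hp hs A B C
  unfold mutualInfo at this
  linarith

lemma entropy_inf_le (hp : ∀ ω, 0 < p ω) (hs : ∑ ω, p ω = 1) (A B : Setoid Ω) :
    entropy p (A ⊓ B) ≤ entropy p A + entropy p B := by
  have := entropy_submodular hp hs A B ⊤
  simpa [entropy_top hs] using this

/-- Gibbs' inequality against the uniform law on `M`: the sum of `p ω / mass` counts the values that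
`f` attains, which is at most `M.card`. -/
lemma entropy_ker_le_log_card (hp : ∀ ω, 0 < p ω) (hs : ∑ ω, p ω = 1) {α : Type*} (f : Ω → α)
    (M : Finset α) (hf : ∀ ω, f ω ∈ M) : entropy p (Setoid.ker f) ≤ Real.log M.card := by
  classical
  have hne : Nonempty Ω := by
    by_contra h
    rw [not_nonempty_iff] at h
    simp at hs
  have hM : (0 : ℝ) < M.card := by
    exact_mod_cast Finset.card_pos.2 ⟨_, hf hne.some⟩
  have hcount : ∑ ω, p ω / mass p (Setoid.ker f) ω ≤ M.card := by
    rw [← Finset.sum_fiberwise_of_maps_to (s := Finset.univ) (t := M) (g := f)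
      (fun ω _ => hf ω), Finset.cast_card]
    refine Finset.sum_le_sum fun a _ => ?_
    by_cases ha : ∃ ω₀, f ω₀ = a
    · obtain ⟨ω₀, rfl⟩ := ha
      have : ∀ ω ∈ Finset.univ.filter (fun ω => f ω = f ω₀), p ω / mass p (Setoid.ker f) ω
          = p ω / mass p (Setoid.ker f) ω₀ := by
        intro ω hω
        rw [mass_congr (show (Setoid.ker f) ω ω₀ from (Finset.mem_filter.1 hω).2)]
      rw [Finset.sum_congr rfl this, ← Finset.sum_div, Finset.sum_filter]
      refine le_of_eq ((div_eq_one_iff_eq (mass_pos hp _ _).ne').2 ?_)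
      unfold mass
      refine Finset.sum_congr rfl fun x _ => ?_
      simp only [Setoid.ker_def, eq_comm]
    · rw [Finset.filter_false_of_mem fun ω _ h => ha ⟨ω, h⟩]
      simp
  have key : ∀ ω, - (p ω * Real.log (mass p (Setoid.ker f) ω))
      ≤ p ω * Real.log M.card + (p ω / mass p (Setoid.ker f) ω / M.card - p ω) := by
    intro ω
    have m := mass_pos hp (Setoid.ker f) ω
    have hl := Real.log_le_sub_one_of_pos (x := 1 / (mass p (Setoid.ker f) ω * M.card))
      (by positivity)
    rw [Real.log_div one_ne_zero (by positivity), Real.log_one, Real.log_mul m.ne' hM.ne'] at hl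
    have h2 := mul_le_mul_of_nonneg_left hl (hp ω).le
    have h3 : p ω / mass p (Setoid.ker f) ω / M.card
        = p ω * (1 / (mass p (Setoid.ker f) ω * M.card)) := by field_simp
    rw [h3]
    linarith
  unfold entropy
  rw [← Finset.sum_neg_distrib]
  refine (Finset.sum_le_sum fun ω _ => key ω).trans ?_
  rw [Finset.sum_add_distrib, Finset.sum_sub_distrib, ← Finset.sum_mul, ← Finset.sum_div, hs]
  have := (div_le_one hM).2 hcount
  linarith

end Entropy

/-! ### Collision probability of nearly uniform laws. -/

section Collision

/-- At `z = N x(v)`, summed over all `N` values `v`, this expression gives `N` times the relative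
entropy of `x` to the uniform law. Being nonnegative termwise, it may be summed over a subset. -/
lemma entropyGap_nonneg {z : ℝ} (hz : 0 ≤ z) : 0 ≤ z * Real.log z - z + 1 := by
  rcases hz.eq_or_lt with rfl | hz
  · simp
  have := Real.log_le_sub_one_of_pos (inv_pos.2 hz)
  rw [Real.log_inv] at this
  have h2 := mul_le_mul_of_nonneg_left this hz.le
  have h3 : z * (z⁻¹ - 1) = 1 - z := by field_simp
  linarith

/-- The logarithm inequality, scaled to be sharp at `z = 1/2`, leaves at least `(1 - log 2) / 2 >
1/8`. -/
lemma entropyGap_ge_of_le_half {z : ℝ} (hz : 0 ≤ z) (hz2 : z ≤ 1 / 2) :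
    1 / 8 ≤ z * Real.log z - z + 1 := by
  have hl2 := Real.log_two_lt_d9
  have hl3 := Real.log_two_gt_d9
  rcases hz.eq_or_lt with rfl | hz
  · norm_num
  have := Real.log_le_sub_one_of_pos (show 0 < (2 * z)⁻¹ by positivity)
  rw [Real.log_inv, Real.log_mul two_ne_zero hz.ne'] at this
  have h2 := mul_le_mul_of_nonneg_left this hz.le
  have h3 : z * ((2 * z)⁻¹ - 1) = 1 / 2 - z := by field_simp
  nlinarith

/-- If both factors exceed 1/2, the product exceeds 1/4; otherwise one gap is at least 1/8 and makes
the left side nonpositive. -/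
lemma mul_ge_sub_entropyGap {z w : ℝ} (hz : 0 ≤ z) (hw : 0 ≤ w) :
    1 / 4 - 2 * ((z * Real.log z - z + 1) + (w * Real.log w - w + 1)) ≤ z * w := by
  have h1 := entropyGap_nonneg hz
  have h2 := entropyGap_nonneg hw
  by_cases hz2 : z ≤ 1 / 2
  · have := entropyGap_ge_of_le_half hz hz2
    nlinarith [mul_nonneg hz hw]
  by_cases hw2 : w ≤ 1 / 2
  · have := entropyGap_ge_of_le_half hw hw2
    nlinarith [mul_nonneg hz hw]
  push Not at hz2 hw2
  nlinarith

/-- Two independent nearly uniform variables on `{none} ∪ [s]` agree on a value of `[s]` with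
probability about `1 / s`. -/
lemma collision_ge {s : ℕ} (hs : 1 ≤ s) (x y : Option (Fin s) → ℝ) (hx : ∀ v, 0 ≤ x v)
    (hy : ∀ v, 0 ≤ y v) (hx1 : ∑ v, x v = 1) (hy1 : ∑ v, y v = 1) :
    1 / ((s : ℝ) + 1) * (1 / 8 - 2 * ((∑ v, x v * Real.log (((s : ℝ) + 1) * x v))
      + ∑ v, y v * Real.log (((s : ℝ) + 1) * y v))) ≤ ∑ a : Fin s, x (some a) * y (some a) := by
  have hN : (0 : ℝ) < (s : ℝ) + 1 := by positivity
  set N : ℝ := (s : ℝ) + 1 with hNdef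
  have hs' : (1 : ℝ) ≤ s := by exact_mod_cast hs
  -- Agreement on `none` does not count as a collision; its gap is nonnegative and is dropped.
  have gap : ∀ z : Option (Fin s) → ℝ, (∀ v, 0 ≤ z v) → ∑ v, z v = 1 →
      ∑ a : Fin s, (N * z (some a) * Real.log (N * z (some a)) - N * z (some a) + 1)
        ≤ N * ∑ v, z v * Real.log (N * z v) := by
    intro z hz hz1
    have h0 := entropyGap_nonneg (mul_nonneg hN.le (hz none))
    have h1 : ∑ v, (N * z v * Real.log (N * z v) - N * z v + 1)
        = N * ∑ v, z v * Real.log (N * z v) := by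
      rw [Finset.sum_add_distrib, Finset.sum_sub_distrib, ← Finset.mul_sum, hz1, Finset.mul_sum]
      simp [mul_assoc, hNdef]
    rw [Fintype.sum_option] at h1
    linarith
  have h1 := gap x hx hx1
  have h2 := gap y hy hy1
  have h3 : ∑ a : Fin s, (1 / 4 - 2 * ((N * x (some a) * Real.log (N * x (some a))
        - N * x (some a) + 1) + (N * y (some a) * Real.log (N * y (some a))
        - N * y (some a) + 1))) ≤ ∑ a : Fin s, N * x (some a) * (N * y (some a)) :=
    Finset.sum_le_sum fun a _ => mul_ge_sub_entropyGap (mul_nonneg hN.le (hx _))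
      (mul_nonneg hN.le (hy _))
  rw [Finset.sum_sub_distrib, ← Finset.mul_sum, Finset.sum_add_distrib] at h3
  have h4 : ∑ a : Fin s, N * x (some a) * (N * y (some a))
      = N ^ 2 * ∑ a : Fin s, x (some a) * y (some a) := by
    rw [Finset.mul_sum]
    exact Finset.sum_congr rfl fun a _ => by ring
  have h5 : ∑ _a : Fin s, (1 / 4 : ℝ) = s / 4 := by simp; ring
  rw [h4, h5] at h3
  -- The constant falls from 1/4 to 1/8 because only `s ≥ N / 2` of the `N` values are summed.
  have h6 : N * (1 / 8 - 2 * ((∑ v, x v * Real.log (N * x v)) + ∑ v, y v * Real.log (N * y v)))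
      ≤ N ^ 2 * ∑ a : Fin s, x (some a) * y (some a) := by
    nlinarith
  rw [one_div, inv_mul_le_iff₀ hN]
  nlinarith

end Collision

/-! ### Mutual information forced by the absence of collisions. -/

section Conditional

variable {Ω : Type} [Fintype Ω] {p : Ω → ℝ}

open scoped Classical in
/-- The conditional probability that `a` takes the value `v`. -/
noncomputable def condProb {α : Type} (p : Ω → ℝ) (C : Setoid Ω) (a : Ω → α) (v : α) : Ω → ℝ :=
  condAvg p C fun ω => if a ω = v then 1 else 0

lemma condProb_nonneg (hp : ∀ ω, 0 < p ω) {α : Type} (C : Setoid Ω) (a : Ω → α) (v : α) (ω : Ω) :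
    0 ≤ condProb p C a v ω :=
  condAvg_nonneg hp (fun _ => by split_ifs <;> norm_num) ω

lemma condProb_sum (hp : ∀ ω, 0 < p ω) {α : Type} [Fintype α] (C : Setoid Ω) (a : Ω → α) (ω : Ω) :
    ∑ v, condProb p C a v ω = 1 := by
  classical
  unfold condProb condAvg
  rw [← Finset.sum_div, Finset.sum_comm, div_eq_one_iff_eq (mass_pos hp C ω).ne']
  unfold mass
  refine Finset.sum_congr rfl fun x _ => ?_
  by_cases h : C ω x <;> simp [h]

lemma condProb_self {α : Type} (C : Setoid Ω) (a : Ω → α) (ω : Ω) :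
    condProb p C a (a ω) ω = mass p (Setoid.ker a ⊓ C) ω / mass p C ω := by
  classical
  unfold condProb condAvg
  congr 1
  unfold mass
  refine Finset.sum_congr rfl fun x _ => ?_
  have : (Setoid.ker a ⊓ C) ω x ↔ a x = a ω ∧ C ω x :=
    ⟨fun h => ⟨(Setoid.ker_def.1 h.1).symm, h.2⟩, fun h => ⟨Setoid.ker_def.2 h.1.symm, h.2⟩⟩
  by_cases h : C ω x <;> by_cases h' : a x = a ω <;> simp [this, h, h']

/-- The deficiency of a conditional entropy as an average of relative entropies to the uniform
law. -/
lemma sum_condProb_mul_log (hp : ∀ ω, 0 < p ω) (hs : ∑ ω, p ω = 1) {α : Type} [Fintype α]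
    (C : Setoid Ω) (a : Ω → α) {N : ℝ} (hN : 0 < N) :
    ∑ ω, p ω * ∑ v, condProb p C a v ω * Real.log (N * condProb p C a v ω)
      = Real.log N - (entropy p (Setoid.ker a ⊓ C) - entropy p C) := by
  classical
  have h1 : ∑ ω, p ω * ∑ v, condProb p C a v ω * Real.log (N * condProb p C a v ω)
      = ∑ v, ∑ ω, p ω * (Real.log (N * condProb p C a v ω) * condProb p C a v ω) := by
    simp_rw [Finset.mul_sum]
    rw [Finset.sum_comm]
    exact Finset.sum_congr rfl fun _ _ => Finset.sum_congr rfl fun _ _ => by ring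
  -- The logarithm is constant on classes of `C`, so the tower property replaces the outer
  -- probability by the indicator.
  have h2 : ∀ v, ∑ ω, p ω * (Real.log (N * condProb p C a v ω) * condProb p C a v ω)
      = ∑ ω, p ω * (Real.log (N * condProb p C a v ω) * if a ω = v then 1 else 0) := by
    intro v
    refine sum_mul_condAvg hp C _ _ fun ω ω' h => ?_
    unfold condProb
    rw [condAvg_congr h]
  rw [h1, Finset.sum_congr rfl fun v _ => h2 v, Finset.sum_comm]
  have h3 : ∀ ω, ∑ v, p ω * (Real.log (N * condProb p C a v ω) * if a ω = v then 1 else 0)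
      = p ω * Real.log N + (p ω * Real.log (mass p (Setoid.ker a ⊓ C) ω)
        - p ω * Real.log (mass p C ω)) := by
    intro ω
    simp only [mul_ite, mul_one, mul_zero, Finset.sum_ite_eq, Finset.mem_univ, if_true]
    have m1 := mass_pos hp (Setoid.ker a ⊓ C) ω
    have m2 := mass_pos hp C ω
    rw [condProb_self, Real.log_mul hN.ne' (by positivity), Real.log_div m1.ne' m2.ne']
    ring
  rw [Finset.sum_congr rfl fun ω _ => h3 ω, Finset.sum_add_distrib, Finset.sum_sub_distrib,
    ← Finset.sum_mul, hs]
  unfold entropy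
  ring

open scoped Classical in
/-- If `a` and `b` never collide on the event `D` of the partition `C`, then they have mutual
information given `C`, unless they are far from uniform. -/
lemma mutualInfo_ge_of_no_collision (hp : ∀ ω, 0 < p ω) (hs : ∑ ω, p ω = 1) {s : ℕ} (hs1 : 1 ≤ s)
    (C : Setoid Ω) (a b : Ω → Option (Fin s)) (D : Ω → Prop)
    (hD : ∀ ω ω', C ω ω' → (D ω ↔ D ω')) (hab : ∀ ω, D ω → a ω = b ω → a ω = none) :
    1 / ((s : ℝ) + 1) * ((∑ ω, if D ω then p ω else 0) / 8
      - 2 * ((Real.log ((s : ℝ) + 1) - (entropy p (Setoid.ker a ⊓ C) - entropy p C))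
        + (Real.log ((s : ℝ) + 1) - (entropy p (Setoid.ker b ⊓ C) - entropy p C))))
      ≤ mutualInfo p (Setoid.ker a) (Setoid.ker b) C := by
  have hN : (0 : ℝ) < (s : ℝ) + 1 := by positivity
  -- `ν` is the chance that `b`, resampled within the class of `C`, hits `a ω` on `D`. Its average
  -- `κ` is the collision probability of the decoupled law given `C`. True pairs never collide on
  -- `D`, so the decoupled law weighted by the density ratio lives on non-colliding pairs and has
  -- conditional mass at most `1 - κ`. Since `exp κ * (1 - κ) ≤ 1`, the tilt `κ` is admissible in
  -- `sum_mul_le_mutualInfo`.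
  set ν : Ω → ℝ := fun ω =>
    (∑ ω', if C ω ω' ∧ D ω ∧ a ω = b ω' ∧ a ω ≠ none then p ω' else 0) / mass p C ω with hν
  set κ : Ω → ℝ := condAvg p C ν with hκ
  have hκC : ∀ ω ω', C ω ω' → κ ω = κ ω' := fun ω ω' h => condAvg_congr h
  have hκsum : ∑ ω, p ω * κ ω = ∑ ω, p ω * ν ω := by
    simpa using sum_mul_condAvg hp C (fun _ => 1) ν fun _ _ _ => rfl
  have hνeq : ∀ ω, ν ω = ∑ c : Fin s, (if D ω then condProb p C b (some c) ω else 0)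
      * (if a ω = some c then 1 else 0) := by
    intro ω
    by_cases hd : D ω
    · cases ha : a ω with
      | none => simp [hν, ha]
      | some c =>
        simp only [hν, ha, hd, condProb, condAvg, if_true, Option.some.injEq, mul_ite, mul_one,
          mul_zero, Finset.sum_ite_eq, Finset.mem_univ]
        congr 1
        refine Finset.sum_congr rfl fun x _ => ?_
        by_cases h : C ω x <;> by_cases h' : b x = some c <;> simp [h, h', eq_comm]
    · simp [hν, hd]
  have hlow : ∑ ω, p ω * ν ω = ∑ ω, p ω * (if D ω then
      ∑ c : Fin s, condProb p C a (some c) ω * condProb p C b (some c) ω else 0) := by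
    have h1 : ∀ c : Fin s, ∑ ω, p ω * ((if D ω then condProb p C b (some c) ω else 0)
        * condProb p C a (some c) ω)
        = ∑ ω, p ω * ((if D ω then condProb p C b (some c) ω else 0)
          * (if a ω = some c then 1 else 0)) := by
      intro c
      refine (sum_mul_condAvg hp C _ _ fun ω ω' h => ?_).trans ?_
      · simp only [hD ω ω' h]
        unfold condProb
        rw [condAvg_congr h]
      · congr!
    calc ∑ ω, p ω * ν ω = ∑ ω, ∑ c : Fin s, p ω * ((if D ω then condProb p C b (some c) ω else 0)
          * (if a ω = some c then 1 else 0)) := by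
          refine Finset.sum_congr rfl fun ω _ => ?_
          rw [hνeq, Finset.mul_sum]
      _ = ∑ c : Fin s, ∑ ω, p ω * ((if D ω then condProb p C b (some c) ω else 0)
          * condProb p C a (some c) ω) := by
          rw [Finset.sum_comm]
          exact Finset.sum_congr rfl fun c _ => (h1 c).symm
      _ = _ := by
          rw [Finset.sum_comm]
          refine Finset.sum_congr rfl fun ω _ => ?_
          rw [← Finset.mul_sum]
          by_cases hd : D ω
          · simp only [hd, if_true]
            congr 1
            exact Finset.sum_congr rfl fun c _ => mul_comm _ _
          · simp [hd]
  set dx : Ω → ℝ := fun ω => ∑ v, condProb p C a v ω * Real.log (((s : ℝ) + 1) * condProb p C a v ω)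
    with hdx
  set dy : Ω → ℝ := fun ω => ∑ v, condProb p C b v ω * Real.log (((s : ℝ) + 1) * condProb p C b v ω)
    with hdy
  -- Nonnegativity of the relative entropies makes the pointwise bound trivial off `D`.
  have hd0 : ∀ (e : Ω → Option (Fin s)) (ω : Ω), 0 ≤ ∑ v, condProb p C e v ω
      * Real.log (((s : ℝ) + 1) * condProb p C e v ω) := by
    intro e ω
    have h1 : ∑ v, (((s : ℝ) + 1) * condProb p C e v ω
          * Real.log (((s : ℝ) + 1) * condProb p C e v ω)
          - ((s : ℝ) + 1) * condProb p C e v ω + 1)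
        = ((s : ℝ) + 1) * ∑ v, condProb p C e v ω
          * Real.log (((s : ℝ) + 1) * condProb p C e v ω) := by
      rw [Finset.sum_add_distrib, Finset.sum_sub_distrib, ← Finset.mul_sum, condProb_sum hp,
        Finset.mul_sum]
      simp [mul_assoc]
    have h2 : 0 ≤ ∑ v, (((s : ℝ) + 1) * condProb p C e v ω
          * Real.log (((s : ℝ) + 1) * condProb p C e v ω)
          - ((s : ℝ) + 1) * condProb p C e v ω + 1) :=
      Finset.sum_nonneg fun v _ =>
        entropyGap_nonneg (mul_nonneg hN.le (condProb_nonneg hp C e v ω))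
    rw [h1] at h2
    exact nonneg_of_mul_nonneg_right h2 hN
  have hpt : ∀ ω, p ω * (1 / ((s : ℝ) + 1) * ((if D ω then 1 else 0) / 8 - 2 * (dx ω + dy ω)))
      ≤ p ω * (if D ω then
        ∑ c : Fin s, condProb p C a (some c) ω * condProb p C b (some c) ω else 0) := by
    intro ω
    refine mul_le_mul_of_nonneg_left ?_ (hp ω).le
    by_cases hd : D ω
    · simp only [hd, if_true]
      exact collision_ge hs1 _ _ (fun v => condProb_nonneg hp C a v ω)
        (fun v => condProb_nonneg hp C b v ω) (condProb_sum hp C a ω) (condProb_sum hp C b ω)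
    · simp only [hd, if_false]
      have := hd0 a ω
      have := hd0 b ω
      refine mul_nonpos_of_nonneg_of_nonpos (by positivity) ?_
      simp only [hdx, hdy]
      linarith
  have hsum := Finset.sum_le_sum fun ω (_ : ω ∈ Finset.univ) => hpt ω
  rw [← hlow, ← hκsum] at hsum
  have hleft : ∑ ω, p ω * (1 / ((s : ℝ) + 1) * ((if D ω then 1 else 0) / 8 - 2 * (dx ω + dy ω)))
      = 1 / ((s : ℝ) + 1) * ((∑ ω, if D ω then p ω else 0) / 8
        - 2 * (∑ ω, p ω * dx ω + ∑ ω, p ω * dy ω)) := by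
    rw [← Finset.sum_add_distrib, Finset.mul_sum, Finset.sum_div, ← Finset.sum_sub_distrib,
      Finset.mul_sum]
    refine Finset.sum_congr rfl fun ω _ => ?_
    split_ifs <;> ring
  rw [hleft, sum_condProb_mul_log hp hs C a hN, sum_condProb_mul_log hp hs C b hN] at hsum
  refine hsum.trans (sum_mul_le_mutualInfo hp hs _ _ C κ ?_)
  refine (sum_decoupled_le hp (Setoid.ker a) (Setoid.ker b) C (fun ω => Real.exp (κ ω))
    (fun _ => (Real.exp_pos _).le) (fun ω ω' h => by rw [hκC ω ω' h])
    (fun ω ω' => ¬ (D ω ∧ a ω = b ω' ∧ a ω ≠ none)) ?_).trans ?_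
  · rintro ω ω₁ ω₂ ⟨h1, h1'⟩ ⟨h2, -⟩ ⟨h3, h4, h5⟩
    have e1 : a ω = a ω₁ := h1
    have e2 : b ω = b ω₂ := h2
    exact h5 (e1 ▸ hab ω ((hD ω ω₁ h1').2 h3) (by rw [e1, e2, h4]))
  · have h1 : ∀ ω, (∑ ω', if C ω ω' ∧ ¬ (D ω ∧ a ω = b ω' ∧ a ω ≠ none) then p ω' else 0)
        / mass p C ω = 1 - ν ω := by
      intro ω
      have m := mass_pos hp C ω
      rw [eq_sub_iff_add_eq, hν]
      simp only
      rw [← add_div, ← Finset.sum_add_distrib, div_eq_one_iff_eq m.ne']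
      unfold mass
      refine Finset.sum_congr rfl fun x _ => ?_
      split_ifs <;> first | (exfalso; tauto) | simp
    have h2 : ∑ ω, p ω * (Real.exp (κ ω) * (1 - ν ω)) = ∑ ω, p ω * (Real.exp (κ ω) * (1 - κ ω)) := by
      have := sum_mul_condAvg hp C (fun ω => Real.exp (κ ω)) ν
        fun ω ω' h => by rw [hκC ω ω' h]
      simp only [mul_sub, Finset.sum_sub_distrib]
      rw [this]
    have h4 : ∀ ω, p ω * (Real.exp (κ ω) * (1 - κ ω)) ≤ p ω := by
      intro ω
      have h3 : Real.exp (κ ω) * (1 - κ ω) ≤ 1 := by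
        have h4 := Real.add_one_le_exp (-κ ω)
        calc Real.exp (κ ω) * (1 - κ ω) ≤ Real.exp (κ ω) * Real.exp (-κ ω) :=
              mul_le_mul_of_nonneg_left (by linarith) (Real.exp_pos _).le
          _ = 1 := by rw [← Real.exp_add]; simp
      have := mul_le_mul_of_nonneg_left h3 (hp ω).le
      linarith
    refine (le_of_eq (Finset.sum_congr rfl fun ω _ => ?_)).trans
      (h2.le.trans ((Finset.sum_le_sum fun ω _ => h4 ω).trans hs.le))
    rw [← h1 ω]
    congr!

end Conditional

/-! ### Conversations do not create mutual information. -/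

section Protocol

variable {Ω : Type} [Fintype Ω] {p : Ω → ℝ}

/-- A message that is determined by `A` and `C` does not increase the mutual information. -/
lemma mutualInfo_inf_le (hp : ∀ ω, 0 < p ω) (hs : ∑ ω, p ω = 1) {A B C D : Setoid Ω}
    (h : A ⊓ C ≤ D) : mutualInfo p A B (C ⊓ D) ≤ mutualInfo p A B C := by
  have h1 : A ⊓ (C ⊓ D) = A ⊓ C := by rw [← inf_assoc]; exact inf_eq_left.2 h
  have h2 : A ⊓ B ⊓ (C ⊓ D) = A ⊓ B ⊓ C := by
    rw [← inf_assoc]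
    exact inf_eq_left.2 (le_trans (inf_le_inf_right _ inf_le_left) h)
  have h3 := entropy_submodular hp hs B D C
  rw [show B ⊓ D ⊓ C = B ⊓ (C ⊓ D) by ac_rfl, inf_comm D C] at h3
  unfold mutualInfo
  rw [h1, h2]
  linarith

lemma mutualInfo_mono_right (hp : ∀ ω, 0 < p ω) (hs : ∑ ω, p ω = 1) (A : Setoid Ω)
    {B B' : Setoid Ω} (C : Setoid Ω) (h : B ≤ B') : mutualInfo p A B' C ≤ mutualInfo p A B C := by
  have h1 := entropy_submodular hp hs A B (B' ⊓ C)
  rw [show A ⊓ B ⊓ (B' ⊓ C) = A ⊓ (B ⊓ B') ⊓ C by ac_rfl, ← inf_assoc B, inf_eq_left.2 h,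
    ← inf_assoc A] at h1
  unfold mutualInfo
  linarith

/-- Conditioning on more decreases the conditional entropy. -/
lemma entropy_inf_sub_anti (hp : ∀ ω, 0 < p ω) (hs : ∑ ω, p ω = 1) (A : Setoid Ω)
    {C D : Setoid Ω} (h : D ≤ C) :
    entropy p (A ⊓ D) - entropy p D ≤ entropy p (A ⊓ C) - entropy p C := by
  have h1 := entropy_submodular hp hs A D C
  rw [inf_assoc, inf_eq_left.2 h] at h1
  linarith

lemma mutualInfo_comm (A B C : Setoid Ω) : mutualInfo p A B C = mutualInfo p B A C := by
  unfold mutualInfo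
  rw [inf_comm A B]
  ring

namespace TwoParty

variable {X Y : Type}

/-- What Alice says at the root: the answer or the next bit, if it is her turn. -/
def aliceRoot : TwoParty X Y → X → Option Bool
  | aliceAnswers out, x => some (out x)
  | bobAnswers _, _ => none
  | aliceSends bit _, x => some (bit x)
  | bobSends _ _, _ => none

/-- What Bob says at the root: the answer or the next bit, if it is his turn. -/
def bobRoot : TwoParty X Y → Y → Option Bool
  | aliceAnswers _, _ => none
  | bobAnswers out, y => some (out y)
  | aliceSends _ _, _ => none
  | bobSends bit _, y => some (bit y)

/-- The protocol that is left after the first bit. -/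
def afterRoot : TwoParty X Y → X → Y → TwoParty X Y
  | aliceAnswers out, _, _ => aliceAnswers out
  | bobAnswers out, _, _ => bobAnswers out
  | aliceSends bit next, x, _ => next (bit x)
  | bobSends bit next, _, y => next (bit y)

/-- The transcript together with the answer. -/
def outcome (P : TwoParty X Y) (x : X) (y : Y) : Message × Bool := (P.transcript x y, P.answer x y)

lemma afterRoot_eq {P : TwoParty X Y} {x x' : X} {y y' : Y}
    (ha : P.aliceRoot x = P.aliceRoot x') (hb : P.bobRoot y = P.bobRoot y') :
    P.afterRoot x y = P.afterRoot x' y' := by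
  cases P <;> simp_all [aliceRoot, bobRoot, afterRoot]

/-- Peels off one node. Since the silent player says `none`, both speakers and the leaves are
treated alike. -/
lemma outcome_eq_iff (P : TwoParty X Y) (x x' : X) (y y' : Y) :
    P.outcome x y = P.outcome x' y' ↔ (P.aliceRoot x = P.aliceRoot x' ∧ P.bobRoot y = P.bobRoot y')
      ∧ (P.afterRoot x y).outcome x y = (P.afterRoot x' y').outcome x' y' := by
  cases P with
  | aliceAnswers out => simp [outcome, aliceRoot, bobRoot, afterRoot, transcript, answer]
  | bobAnswers out => simp [outcome, aliceRoot, bobRoot, afterRoot, transcript, answer]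
  | aliceSends bit next =>
    simp [outcome, aliceRoot, bobRoot, afterRoot, transcript, answer, and_assoc]
  | bobSends bit next =>
    simp [outcome, aliceRoot, bobRoot, afterRoot, transcript, answer, and_assoc]

lemma length_transcript_afterRoot (P : TwoParty X Y) (x : X) (y : Y) :
    ((P.afterRoot x y).transcript x y).length = (P.transcript x y).length - 1 := by
  cases P <;> simp [afterRoot, transcript]

lemma outcome_eq_of_length_eq_zero {P : TwoParty X Y} {x x' : X} {y y' : Y}
    (h : (P.transcript x y).length = 0) (ha : P.aliceRoot x = P.aliceRoot x')
    (hb : P.bobRoot y = P.bobRoot y') : P.outcome x y = P.outcome x' y' := by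
  cases P <;> simp_all [outcome, aliceRoot, bobRoot, transcript, answer]

/-- Running a two-party protocol does not increase the mutual information of the inputs. -/
lemma mutualInfo_outcome_le (hp : ∀ ω, 0 < p ω) (hs : ∑ ω, p ω = 1) (x : Ω → X) (y : Ω → Y)
    {A B : Setoid Ω} (hA : A ≤ Setoid.ker x) (hB : B ≤ Setoid.ker y) (m : ℕ) :
    ∀ (C : Setoid Ω) (P : Ω → TwoParty X Y), C ≤ Setoid.ker P →
      (∀ ω, ((P ω).transcript (x ω) (y ω)).length ≤ m) →
      mutualInfo p A B (C ⊓ Setoid.ker fun ω => (P ω).outcome (x ω) (y ω))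
        ≤ mutualInfo p A B C := by
  -- The word of Alice at the root is determined by `A` and `C`, that of Bob by `B` and `C`, so
  -- `mutualInfo_inf_le` applies from either side.
  have step : ∀ (C : Setoid Ω) (P : Ω → TwoParty X Y), C ≤ Setoid.ker P →
      mutualInfo p A B (C ⊓ Setoid.ker (fun ω => (P ω).aliceRoot (x ω))
        ⊓ Setoid.ker (fun ω => (P ω).bobRoot (y ω))) ≤ mutualInfo p A B C := by
    intro C P hP
    refine le_trans ?_ (mutualInfo_inf_le hp hs (A := A) (B := B) (C := C)
      (D := Setoid.ker (fun ω => (P ω).aliceRoot (x ω))) ?_)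
    · rw [mutualInfo_comm A, mutualInfo_comm A]
      refine mutualInfo_inf_le hp hs ?_
      intro ω ω' h
      have h1 : P ω = P ω' := hP h.2.1
      have h2 : y ω = y ω' := hB h.1
      change (P ω).bobRoot (y ω) = (P ω').bobRoot (y ω')
      rw [h1, h2]
    · intro ω ω' h
      have h1 : P ω = P ω' := hP h.2
      have h2 : x ω = x ω' := hA h.1
      change (P ω).aliceRoot (x ω) = (P ω').aliceRoot (x ω')
      rw [h1, h2]
  -- The tree is itself random but known from the conditioning; after the root has spoken, this
  -- holds again for the remaining tree.
  induction m with
  | zero =>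
    intro C P hP hlen
    -- An empty transcript still comes with an answer, so the base case uses one step too.
    convert step C P hP using 2
    ext ω ω'
    constructor
    · rintro ⟨h1, h2⟩
      have e : P ω = P ω' := hP h1
      have h2' : (P ω).outcome (x ω) (y ω) = (P ω').outcome (x ω') (y ω') := h2
      rw [← e, outcome_eq_iff] at h2'
      refine ⟨⟨h1, ?_⟩, ?_⟩
      · change (P ω).aliceRoot (x ω) = (P ω').aliceRoot (x ω')
        rw [← e]; exact h2'.1.1
      · change (P ω).bobRoot (y ω) = (P ω').bobRoot (y ω')
        rw [← e]; exact h2'.1.2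
    · rintro ⟨⟨h1, h2⟩, h3⟩
      have e : P ω = P ω' := hP h1
      have h2' : (P ω).aliceRoot (x ω) = (P ω').aliceRoot (x ω') := h2
      have h3' : (P ω).bobRoot (y ω) = (P ω').bobRoot (y ω') := h3
      refine ⟨h1, ?_⟩
      change (P ω).outcome (x ω) (y ω) = (P ω').outcome (x ω') (y ω')
      rw [← e] at h2' h3' ⊢
      exact outcome_eq_of_length_eq_zero (Nat.le_zero.1 (hlen ω)) h2' h3'
  | succ m ih =>
    intro C P hP hlen
    refine le_trans ?_ (step C P hP)
    refine le_trans (le_of_eq ?_) (ih _ (fun ω => (P ω).afterRoot (x ω) (y ω)) ?_ ?_)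
    · congr 1
      ext ω ω'
      constructor
      · rintro ⟨h1, h2⟩
        have e : P ω = P ω' := hP h1
        have h2' : (P ω).outcome (x ω) (y ω) = (P ω').outcome (x ω') (y ω') := h2
        rw [← e, outcome_eq_iff] at h2'
        refine ⟨⟨⟨h1, ?_⟩, ?_⟩, ?_⟩
        · change (P ω).aliceRoot (x ω) = (P ω').aliceRoot (x ω')
          rw [← e]; exact h2'.1.1
        · change (P ω).bobRoot (y ω) = (P ω').bobRoot (y ω')
          rw [← e]; exact h2'.1.2
        · change ((P ω).afterRoot (x ω) (y ω)).outcome (x ω) (y ω)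
            = ((P ω').afterRoot (x ω') (y ω')).outcome (x ω') (y ω')
          rw [← e]; exact h2'.2
      · rintro ⟨⟨⟨h1, h2⟩, h3⟩, h4⟩
        have e : P ω = P ω' := hP h1
        have h2' : (P ω).aliceRoot (x ω) = (P ω').aliceRoot (x ω') := h2
        have h3' : (P ω).bobRoot (y ω) = (P ω').bobRoot (y ω') := h3
        have h4' : ((P ω).afterRoot (x ω) (y ω)).outcome (x ω) (y ω)
            = ((P ω').afterRoot (x ω') (y ω')).outcome (x ω') (y ω') := h4
        refine ⟨h1, ?_⟩
        change (P ω).outcome (x ω) (y ω) = (P ω').outcome (x ω') (y ω')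
        rw [← e] at h2' h3' h4' ⊢
        exact (outcome_eq_iff _ _ _ _ _).2 ⟨⟨h2', h3'⟩, h4'⟩
    · rintro ω ω' ⟨⟨h1, h2⟩, h3⟩
      have e : P ω = P ω' := hP h1
      have h2' : (P ω).aliceRoot (x ω) = (P ω').aliceRoot (x ω') := h2
      have h3' : (P ω).bobRoot (y ω) = (P ω').bobRoot (y ω') := h3
      change (P ω).afterRoot (x ω) (y ω) = (P ω').afterRoot (x ω') (y ω')
      rw [← e] at h2' h3' ⊢
      exact afterRoot_eq h2' h3'
    · intro ω
      rw [length_transcript_afterRoot]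
      have := hlen ω
      omega

end TwoParty

end Protocol

/-! ### Chain rules over coordinates. -/

section Prefix

variable {Ω : Type}

/-- The partition given by the first `l` coordinates of `X`. -/
def prefixKer {ζ : Type} {t : ℕ} (X : Ω → Fin t → ζ) (l : ℕ) : Setoid Ω where
  r ω ω' := ∀ m : Fin t, m.val < l → X ω m = X ω' m
  iseqv := ⟨fun _ _ _ => rfl, fun h m hm => (h m hm).symm, fun h h' m hm =>
    (h m hm).trans (h' m hm)⟩

lemma prefixKer_zero {ζ : Type} {t : ℕ} (X : Ω → Fin t → ζ) : prefixKer X 0 = ⊤ :=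
  eq_top_iff.2 fun _ _ _ _ hm => absurd hm (Nat.not_lt_zero _)

lemma prefixKer_self {ζ : Type} {t : ℕ} (X : Ω → Fin t → ζ) : prefixKer X t = Setoid.ker X :=
  Setoid.ext fun _ _ => ⟨fun h => funext fun m => h m m.2, fun h m _ => congrFun h m⟩

lemma prefixKer_succ {ζ : Type} {t : ℕ} (X : Ω → Fin t → ζ) (l : Fin t) :
    prefixKer X (l + 1) = Setoid.ker (fun ω => X ω l) ⊓ prefixKer X l := by
  refine Setoid.ext fun ω ω' => ⟨fun h => ⟨h l (Nat.lt_succ_self _), fun m hm =>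
    h m (Nat.lt_succ_of_lt hm)⟩, ?_⟩
  rintro ⟨h1, h2⟩ m hm
  rcases Nat.lt_succ_iff_lt_or_eq.1 hm with h | h
  · exact h2 m h
  · rw [Fin.ext h]
    exact h1

variable [Fintype Ω] {p : Ω → ℝ}

/-- The chain rule for the entropy. -/
lemma sum_entropy_prefixKer {ζ : Type} {t : ℕ} (X : Ω → Fin t → ζ) (C : Setoid Ω) :
    ∑ l : Fin t, (entropy p (Setoid.ker (fun ω => X ω l) ⊓ (C ⊓ prefixKer X l))
      - entropy p (C ⊓ prefixKer X l)) = entropy p (C ⊓ Setoid.ker X) - entropy p C := by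
  have h : ∀ l : Fin t, entropy p (Setoid.ker (fun ω => X ω l) ⊓ (C ⊓ prefixKer X l))
      - entropy p (C ⊓ prefixKer X l)
      = (fun m : ℕ => entropy p (C ⊓ prefixKer X (m + 1)) - entropy p (C ⊓ prefixKer X m)) l := by
    intro l
    simp only
    rw [prefixKer_succ, inf_left_comm]
  rw [Finset.sum_congr rfl fun l _ => h l,
    Fin.sum_univ_eq_sum_range
      (fun m : ℕ => entropy p (C ⊓ prefixKer X (m + 1)) - entropy p (C ⊓ prefixKer X m)) t,
    Finset.sum_range_sub (fun m : ℕ => entropy p (C ⊓ prefixKer X m)), prefixKer_self,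
    prefixKer_zero, inf_top_eq]

/-- The chain rule for the mutual information. -/
lemma sum_mutualInfo_prefixKer {ζ : Type} {t : ℕ} (X : Ω → Fin t → ζ) (A C : Setoid Ω) :
    ∑ l : Fin t, mutualInfo p A (Setoid.ker fun ω => X ω l) (C ⊓ prefixKer X l)
      = mutualInfo p A (Setoid.ker X) C := by
  have h1 := sum_entropy_prefixKer (p := p) X C
  have h2 := sum_entropy_prefixKer (p := p) X (A ⊓ C)
  have h3 : ∀ l : Fin t, mutualInfo p A (Setoid.ker fun ω => X ω l) (C ⊓ prefixKer X l)
      = (entropy p (Setoid.ker (fun ω => X ω l) ⊓ (C ⊓ prefixKer X l))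
          - entropy p (C ⊓ prefixKer X l))
        - (entropy p (Setoid.ker (fun ω => X ω l) ⊓ (A ⊓ C ⊓ prefixKer X l))
          - entropy p (A ⊓ C ⊓ prefixKer X l)) := by
    intro l
    unfold mutualInfo
    rw [show A ⊓ Setoid.ker (fun ω => X ω l) ⊓ (C ⊓ prefixKer X l)
      = Setoid.ker (fun ω => X ω l) ⊓ (A ⊓ C ⊓ prefixKer X l) by ac_rfl, ← inf_assoc A]
    ring
  rw [Finset.sum_congr rfl fun l _ => h3 l, Finset.sum_sub_distrib, h1, h2]
  unfold mutualInfo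
  rw [inf_comm C, inf_right_comm A C]
  ring

open scoped Classical in
/-- If `X` and `T` never collide on the event `D` of the partition `F`, then they have mutual
information given `F`, unless they are far from uniform. -/
lemma mutualInfo_ge_of_disjoint (hp : ∀ ω, 0 < p ω) (hs : ∑ ω, p ω = 1) {s : ℕ} (hs1 : 1 ≤ s)
    (F : Setoid Ω) (X T : Ω → Fin s → Option (Fin s)) (D : Ω → Prop)
    (hD : ∀ ω ω', F ω ω' → (D ω ↔ D ω'))
    (hXT : ∀ ω, D ω → ∀ l, X ω l = T ω l → X ω l = none) :
    1 / ((s : ℝ) + 1) * (s * (∑ ω, if D ω then p ω else 0) / 8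
      - 2 * (2 * s * Real.log ((s : ℝ) + 1)
        - (entropy p (Setoid.ker X ⊓ Setoid.ker T ⊓ F) - entropy p F)))
      ≤ mutualInfo p (Setoid.ker X) (Setoid.ker T) F := by
  set N : ℝ := (s : ℝ) + 1 with hN
  set PD : ℝ := ∑ ω, if D ω then p ω else 0 with hPD
  set h : ℕ → Setoid Ω := fun l => prefixKer X l ⊓ prefixKer T l ⊓ F with hh
  set J : ℕ → ℝ := fun l => mutualInfo p (prefixKer X l) (prefixKer T l) F with hJ
  -- Replacing each variable's own past by the joint past `h l` only lowers the entropies of `a` and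
  -- `b`, so the increment of `J` dominates their mutual information given `h l`. The sum of these
  -- two conditional entropies is at least their joint one, which telescopes.
  have hstep : ∀ l : Fin s, 1 / N * (PD / 8 - 2 * (2 * Real.log N
      - (entropy p (h (l + 1)) - entropy p (h l)))) ≤ J (l + 1) - J l := by
    intro l
    set a : Ω → Option (Fin s) := fun ω => X ω l
    set b : Ω → Option (Fin s) := fun ω => T ω l
    have hsucc : h (l + 1) = Setoid.ker a ⊓ Setoid.ker b ⊓ h l := by
      simp only [hh, prefixKer_succ]
      ac_rfl
    have h1 := mutualInfo_ge_of_no_collision hp hs hs1 (h l) a b D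
      (fun ω ω' hω => hD ω ω' hω.2) (fun ω hω => hXT ω hω l)
    have h2 := mutualInfo_nonneg hp hs (Setoid.ker a) (Setoid.ker b) (h l)
    have h3 := entropy_submodular hp hs (Setoid.ker a) (prefixKer T l) (prefixKer X l ⊓ F)
    have h4 := entropy_submodular hp hs (Setoid.ker b) (prefixKer X l) (prefixKer T l ⊓ F)
    rw [show Setoid.ker a ⊓ prefixKer T l ⊓ (prefixKer X l ⊓ F) = Setoid.ker a ⊓ h l by
        simp only [hh]; ac_rfl,
      show prefixKer T l ⊓ (prefixKer X l ⊓ F) = h l by simp only [hh]; ac_rfl,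
      show Setoid.ker a ⊓ (prefixKer X l ⊓ F) = prefixKer X (l + 1) ⊓ F by
        rw [prefixKer_succ, inf_assoc]] at h3
    rw [show Setoid.ker b ⊓ prefixKer X l ⊓ (prefixKer T l ⊓ F) = Setoid.ker b ⊓ h l by
        simp only [hh]; ac_rfl,
      show prefixKer X l ⊓ (prefixKer T l ⊓ F) = h l by simp only [hh]; ac_rfl,
      show Setoid.ker b ⊓ (prefixKer T l ⊓ F) = prefixKer T (l + 1) ⊓ F by
        rw [prefixKer_succ, inf_assoc]] at h4
    have hJ1 : J (l + 1) = entropy p (prefixKer X (l + 1) ⊓ F) + entropy p (prefixKer T (l + 1) ⊓ F)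
        - entropy p (h (l + 1)) - entropy p F := rfl
    have hJ0 : J l = entropy p (prefixKer X l ⊓ F) + entropy p (prefixKer T l ⊓ F)
        - entropy p (h l) - entropy p F := rfl
    have hI : mutualInfo p (Setoid.ker a) (Setoid.ker b) (h l)
        = entropy p (Setoid.ker a ⊓ h l) + entropy p (Setoid.ker b ⊓ h l)
          - entropy p (h (l + 1)) - entropy p (h l) := by
      rw [hsucc]; rfl
    refine le_trans (mul_le_mul_of_nonneg_left ?_ (by positivity)) (h1.trans ?_)
    · rw [hI] at h2
      linarith
    · rw [hI, hJ1, hJ0]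
      linarith
  have hsum := Finset.sum_le_sum fun l (_ : l ∈ (Finset.univ : Finset (Fin s))) => hstep l
  rw [Fin.sum_univ_eq_sum_range (fun l => J (l + 1) - J l) s,
    Fin.sum_univ_eq_sum_range (fun l => 1 / N * (PD / 8 - 2 * (2 * Real.log N
      - (entropy p (h (l + 1)) - entropy p (h l))))) s, Finset.sum_range_sub,
    ← Finset.mul_sum, Finset.sum_sub_distrib, ← Finset.mul_sum, Finset.sum_sub_distrib,
    Finset.sum_range_sub (fun l => entropy p (h l))] at hsum
  have hJs : J s = mutualInfo p (Setoid.ker X) (Setoid.ker T) F := by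
    simp only [hJ, prefixKer_self]
  have hJ0 : J 0 = 0 := by
    simp [hJ, prefixKer_zero, mutualInfo]
  have hhs : h s = Setoid.ker X ⊓ Setoid.ker T ⊓ F := by simp only [hh, prefixKer_self]
  have hh0 : h 0 = F := by simp [hh, prefixKer_zero]
  rw [hJs, hJ0, hhs, hh0] at hsum
  simp only [Finset.sum_const, Finset.card_range, nsmul_eq_mul] at hsum
  refine le_trans (le_of_eq ?_) (hsum.trans_eq (sub_zero _))
  ring

end Prefix

/-! ### Several samples of `T` behind one hint. -/

section Copies

variable {G : Type} [Fintype G] {k : ℕ}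

/-- Inputs `S` together with `t` inputs `T` that all produce the same hint. -/
abbrev Copies (hint : (Fin k → G) → G → Message) (t : ℕ) : Type :=
  {q : (Fin k → G) × (Fin t → G) // ∀ j l, hint q.1 (q.2 j) = hint q.1 (q.2 l)}

/-- The number of inputs `T` with the same hint as `g`. -/
noncomputable def fiberCard (hint : (Fin k → G) → G → Message) (S : Fin k → G) (g : G) : ℕ :=
  (Finset.univ.filter fun g' => hint S g' = hint S g).card

lemma fiberCard_pos (hint : (Fin k → G) → G → Message) (S : Fin k → G) (g : G) :
    0 < fiberCard hint S g :=
  Finset.card_pos.2 ⟨g, by simp⟩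

variable {t : ℕ} [NeZero t]

/-- The law of `S` and of `t` samples of `T` that are independent conditionally on `S` and the
hint. -/
noncomputable def copiesProb (hint : (Fin k → G) → G → Message) (ω : Copies hint t) : ℝ :=
  ((Fintype.card G : ℝ) ^ (k + 1) * (fiberCard hint ω.1.1 (ω.1.2 0) : ℝ) ^ (t - 1))⁻¹

noncomputable instance (hint : (Fin k → G) → G → Message) (t : ℕ) : Fintype (Copies hint t) := by
  classical
  exact Subtype.fintype _

variable (hint : (Fin k → G) → G → Message)

/-- The subtype is exactly the support of the law, so the entropy lemmas may assume strictly
positive weights. -/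
lemma copiesProb_pos [Nonempty G] (ω : Copies hint t) : 0 < copiesProb hint ω := by
  have h1 : (0 : ℝ) < Fintype.card G := by exact_mod_cast Fintype.card_pos
  have h2 : (0 : ℝ) < fiberCard hint ω.1.1 (ω.1.2 0) := by exact_mod_cast fiberCard_pos _ _ _
  unfold copiesProb
  positivity

/-- Each of the samples of `T` is uniform and independent of `S`. -/
lemma sum_copiesProb_mul (φ : (Fin k → G) → G → ℝ) (j : Fin t) :
    ∑ ω : Copies hint t, copiesProb hint ω * φ ω.1.1 (ω.1.2 j)
      = (∑ S, ∑ g, φ S g) / (Fintype.card G : ℝ) ^ (k + 1) := by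
  classical
  set P : (Fin k → G) × (Fin t → G) → Prop := fun q => ∀ j l, hint q.1 (q.2 j) = hint q.1 (q.2 l)
  have h1 : ∑ ω : Copies hint t, copiesProb hint ω * φ ω.1.1 (ω.1.2 j)
      = ∑ S : Fin k → G, ∑ T : Fin t → G, if P (S, T) then
        ((Fintype.card G : ℝ) ^ (k + 1) * (fiberCard hint S (T 0) : ℝ) ^ (t - 1))⁻¹ * φ S (T j)
        else 0 := by
    rw [← Fintype.sum_prod_type', ← Finset.sum_filter]
    rw [Finset.sum_subtype (p := P) (Finset.univ.filter fun q => P q) (fun q => by simp)]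
    rfl
  have hcount : ∀ (S : Fin k → G) (g : G),
      ∑ T ∈ Fintype.piFinset (fun _ : Fin t => Finset.univ.filter fun g' => hint S g' = hint S g),
        (if T j = g then (1 : ℝ) else 0) = (fiberCard hint S g : ℝ) ^ (t - 1) := by
    intro S g
    rw [Fintype.sum_piFinset_apply (fun x => if x = g then (1 : ℝ) else 0)]
    simp [fiberCard]
  rw [h1, Finset.sum_div]
  refine Finset.sum_congr rfl fun S _ => ?_
  -- Tuples are sorted by `g = T j`. All entries share the hint, so the fibre can be measured at `T
  -- j` instead of `T 0`, and the count of tuples cancels the power in the density.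
  have h2 : ∀ T : Fin t → G, (if P (S, T) then
        ((Fintype.card G : ℝ) ^ (k + 1) * (fiberCard hint S (T 0) : ℝ) ^ (t - 1))⁻¹ * φ S (T j)
        else 0)
      = ∑ g, if T ∈ Fintype.piFinset
          (fun _ : Fin t => Finset.univ.filter fun g' => hint S g' = hint S g) then
        ((Fintype.card G : ℝ) ^ (k + 1) * (fiberCard hint S g : ℝ) ^ (t - 1))⁻¹ * φ S g
          * (if T j = g then 1 else 0) else 0 := by
    intro T
    rw [Finset.sum_eq_single (T j)]
    · have hiff : T ∈ Fintype.piFinset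
          (fun _ : Fin t => Finset.univ.filter fun g' => hint S g' = hint S (T j)) ↔ P (S, T) := by
        simp only [Fintype.mem_piFinset, Finset.mem_filter, Finset.mem_univ, true_and]
        exact ⟨fun h a b => (h a).trans (h b).symm, fun h a => h a j⟩
      by_cases hP : P (S, T)
      · rw [if_pos hP, if_pos (hiff.2 hP), if_pos rfl, mul_one]
        have : fiberCard hint S (T 0) = fiberCard hint S (T j) := by
          unfold fiberCard
          rw [show hint S (T 0) = hint S (T j) from hP 0 j]
        rw [this]
      · rw [if_neg hP, if_neg fun h => hP (hiff.1 h)]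
    · intro g _ hg
      rw [if_neg (fun h => hg h.symm : ¬ T j = g), mul_zero, ite_self]
    · intro h
      exact absurd (Finset.mem_univ _) h
  simp_rw [h2]
  rw [Finset.sum_comm, Finset.sum_div]
  refine Finset.sum_congr rfl fun g _ => ?_
  rw [← Finset.sum_filter, Finset.filter_univ_mem, ← Finset.mul_sum, hcount]
  have : (0 : ℝ) < fiberCard hint S g := by exact_mod_cast fiberCard_pos _ _ _
  rw [mul_inv]
  field_simp

variable [Nonempty G]

lemma sum_copiesProb : ∑ ω : Copies hint t, copiesProb hint ω = 1 := by
  have h := sum_copiesProb_mul hint (t := t) (fun _ _ => 1) 0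
  have hG : (0 : ℝ) < Fintype.card G := by exact_mod_cast Fintype.card_pos
  simp only [mul_one] at h
  rw [h]
  simp only [Finset.sum_const, Finset.card_univ, Fintype.card_pi, nsmul_eq_mul, mul_one]
  simp only [Finset.prod_const, Finset.card_univ, Fintype.card_fin, Nat.cast_pow]
  rw [← pow_succ]
  exact div_self (by positivity)

lemma entropy_copies_fst :
    entropy (copiesProb hint) (Setoid.ker fun ω : Copies hint t => ω.1.1)
      = k * Real.log (Fintype.card G) := by
  classical
  have hG : (0 : ℝ) < Fintype.card G := by exact_mod_cast Fintype.card_pos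
  have hm : ∀ ω : Copies hint t, mass (copiesProb hint)
      (Setoid.ker fun ω : Copies hint t => ω.1.1) ω = ((Fintype.card G : ℝ) ^ k)⁻¹ := by
    intro ω
    have h := sum_copiesProb_mul hint (t := t) (fun S _ => if ω.1.1 = S then 1 else 0) 0
    simp only [mul_ite, mul_one, mul_zero, Finset.sum_const, Finset.card_univ, nsmul_eq_mul,
      Finset.sum_ite_eq, Finset.mem_univ, if_true] at h
    unfold mass
    refine Eq.trans ?_ (h.trans ?_)
    · simp only [Setoid.ker_def]
    · rw [pow_succ]
      field_simp
  unfold entropy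
  simp_rw [hm]
  rw [← Finset.sum_mul, sum_copiesProb, Real.log_inv, Real.log_pow]
  ring

/-- For uniform `g`, the mean of `log |G| - log (fiberCard)` is the entropy of the hint, hence at
most `log M.card`. -/
lemma sum_log_fiberCard_ge (M : Finset Message) (hM : ∀ S g, hint S g ∈ M) (S : Fin k → G) :
    (Fintype.card G : ℝ) * (Real.log (Fintype.card G) - Real.log M.card)
      ≤ ∑ g, Real.log (fiberCard hint S g) := by
  classical
  have hG : (0 : ℝ) < Fintype.card G := by exact_mod_cast Fintype.card_pos
  have h := entropy_ker_le_log_card (Ω := G) (p := fun _ => (Fintype.card G : ℝ)⁻¹)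
    (fun _ => inv_pos.2 hG) (by simp) (hint S) M (hM S)
  have hm : ∀ g, mass (fun _ => (Fintype.card G : ℝ)⁻¹) (Setoid.ker (hint S)) g
      = fiberCard hint S g / Fintype.card G := by
    intro g
    unfold mass fiberCard
    rw [← Finset.sum_filter, Finset.sum_const, nsmul_eq_mul, div_eq_mul_inv]
    congr 3
    ext x
    simp [Setoid.ker_def, eq_comm]
  unfold entropy at h
  simp_rw [hm] at h
  have h2 : ∀ g, (Fintype.card G : ℝ)⁻¹ * Real.log (fiberCard hint S g / Fintype.card G)
      = (Fintype.card G : ℝ)⁻¹ * Real.log (fiberCard hint S g)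
        - (Fintype.card G : ℝ)⁻¹ * Real.log (Fintype.card G) := by
    intro g
    have : (0 : ℝ) < fiberCard hint S g := by exact_mod_cast fiberCard_pos _ _ _
    rw [Real.log_div this.ne' hG.ne']
    ring
  simp_rw [h2] at h
  rw [Finset.sum_sub_distrib, ← Finset.mul_sum] at h
  simp only [Finset.sum_const, Finset.card_univ, nsmul_eq_mul] at h
  rw [← mul_assoc, mul_inv_cancel₀ hG.ne', one_mul] at h
  have h3 : Real.log (Fintype.card G) - Real.log M.card
      ≤ (Fintype.card G : ℝ)⁻¹ * ∑ g, Real.log (fiberCard hint S g) := by linarith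
  rwa [le_inv_mul_iff₀ hG] at h3

/-- The partition is discrete, so its entropy is the mean of `-log copiesProb`. Each of the `t - 1`
samples after the first loses on average at most the entropy of the hint. -/
lemma entropy_copies_ge (M : Finset Message) (hM : ∀ S g, hint S g ∈ M)
    {r : Setoid (Copies hint t)} (hr : ∀ ω ω', r ω ω' → ω = ω') :
    (k + t) * Real.log (Fintype.card G) - (t - 1) * Real.log M.card
      ≤ entropy (copiesProb hint) r := by
  classical
  have hG : (0 : ℝ) < Fintype.card G := by exact_mod_cast Fintype.card_pos
  have ht : 1 ≤ t := NeZero.one_le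
  have hm : ∀ ω, mass (copiesProb hint) r ω = copiesProb hint ω := by
    intro ω
    unfold mass
    rw [Finset.sum_eq_single ω]
    · rw [if_pos (r.refl' ω)]
    · intro b _ hb
      rw [if_neg fun h => hb (hr _ _ h).symm]
    · intro h
      exact absurd (Finset.mem_univ _) h
  have hlog : ∀ ω : Copies hint t, copiesProb hint ω * Real.log (copiesProb hint ω)
      = -((k + 1) * Real.log (Fintype.card G) * copiesProb hint ω
        + (t - 1) * (copiesProb hint ω * Real.log (fiberCard hint ω.1.1 (ω.1.2 0)))) := by
    intro ω
    have h2 : (0 : ℝ) < fiberCard hint ω.1.1 (ω.1.2 0) := by exact_mod_cast fiberCard_pos _ _ _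
    have : Real.log (copiesProb hint ω) = -((k + 1) * Real.log (Fintype.card G)
        + (t - 1) * Real.log (fiberCard hint ω.1.1 (ω.1.2 0))) := by
      unfold copiesProb
      rw [Real.log_inv, Real.log_mul (by positivity) (by positivity), Real.log_pow, Real.log_pow,
        Nat.cast_sub ht]
      push_cast
      ring
    rw [this]
    ring
  have havg := sum_copiesProb_mul hint (t := t) (fun S g => Real.log (fiberCard hint S g)) 0
  have hge : Real.log (Fintype.card G) - Real.log M.card
      ≤ (∑ S, ∑ g, Real.log (fiberCard hint S g)) / (Fintype.card G : ℝ) ^ (k + 1) := by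
    rw [le_div_iff₀ (by positivity)]
    refine le_trans (le_of_eq ?_)
      (Finset.sum_le_sum fun S (_ : S ∈ Finset.univ) => sum_log_fiberCard_ge hint M hM S)
    simp only [Finset.sum_const, Finset.card_univ, Fintype.card_pi, nsmul_eq_mul,
      Finset.prod_const, Fintype.card_fin, Nat.cast_pow]
    ring
  unfold entropy
  simp_rw [hm, hlog]
  rw [Finset.sum_neg_distrib, neg_neg, Finset.sum_add_distrib, ← Finset.mul_sum, ← Finset.mul_sum,
    sum_copiesProb, havg]
  have ht' : (0 : ℝ) ≤ (t : ℝ) - 1 := by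
    have : (1 : ℝ) ≤ t := by exact_mod_cast ht
    linarith
  nlinarith [mul_le_mul_of_nonneg_left hge ht']

end Copies

/-! ### Counting short messages. -/

section Messages

/-- The messages of at most `r` bits. -/
def shortMessages (r : ℕ) : Finset Message :=
  (Finset.range (r + 1)).biUnion fun m =>
    (Finset.univ : Finset (Fin m → Bool)).image List.ofFn

lemma mem_shortMessages {r : ℕ} {u : Message} (h : u.length ≤ r) : u ∈ shortMessages r := by
  refine Finset.mem_biUnion.2 ⟨u.length, Finset.mem_range.2 (Nat.lt_succ_of_le h),
    Finset.mem_image.2 ⟨u.get, Finset.mem_univ _, List.ofFn_get u⟩⟩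

lemma card_shortMessages_lt (r : ℕ) : (shortMessages r).card < 2 ^ (r + 1) := by
  have h1 : (shortMessages r).card ≤ ∑ m ∈ Finset.range (r + 1), 2 ^ m := by
    refine Finset.card_biUnion_le.trans (Finset.sum_le_sum fun m _ => ?_)
    refine Finset.card_image_le.trans ?_
    simp
  have h2 : ∀ n : ℕ, ∑ m ∈ Finset.range n, 2 ^ m < 2 ^ n := by
    intro n
    induction n with
    | zero => simp
    | succ n ih =>
      rw [Finset.sum_range_succ, pow_succ]
      omega
  exact h1.trans_lt (h2 _)

lemma card_shortMessages_pos (r : ℕ) : 0 < (shortMessages r).card :=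
  Finset.card_pos.2 ⟨[], mem_shortMessages (Nat.zero_le _)⟩

lemma log_card_shortMessages_le (r : ℕ) : Real.log (shortMessages r).card ≤ r + 1 := by
  have h1 : ((shortMessages r).card : ℝ) ≤ 2 ^ (r + 1) := by
    exact_mod_cast (card_shortMessages_lt r).le
  have h0 : (0 : ℝ) < (shortMessages r).card := by exact_mod_cast card_shortMessages_pos r
  have h2 := Real.log_le_log h0 h1
  rw [Real.log_pow] at h2
  have h3 := Real.log_two_lt_d9
  push_cast at h2
  nlinarith

end Messages

/-! ### The hard distribution. -/

section Encoding

/-- The inputs of the hard distribution: from each of `s` blocks of size `s` at most one element is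
chosen. -/
abbrev Choice (s : ℕ) : Type := Fin s → Option (Fin s)

/-- The subsets given by `x` and `y` are disjoint. -/
def Choice.Avoids {s : ℕ} (x y : Choice s) : Prop := ∀ l, x l = y l → x l = none

open scoped Classical in
/-- The subset of `[n]` with the chosen elements. -/
noncomputable def Choice.toSubset {s n : ℕ} (h : s * s ≤ n) (x : Choice s) : Subset n :=
  Finset.univ.filter fun e => ∃ l a, x l = some a ∧ Fin.castLE h (finProdFinEquiv (l, a)) = e

lemma Choice.disjoint_toSubset {s n : ℕ} (h : s * s ≤ n) (x y : Choice s) :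
    Disjoint (x.toSubset h) (y.toSubset h) ↔ x.Avoids y := by
  classical
  rw [Finset.disjoint_left]
  constructor
  · intro H l hl
    cases hx : x l with
    | none => rfl
    | some a =>
      exact absurd (Finset.mem_filter.2 ⟨Finset.mem_univ _, l, a, hl ▸ hx, rfl⟩)
        (H (Finset.mem_filter.2 ⟨Finset.mem_univ _, l, a, hx, rfl⟩))
  · intro H e hx hy
    obtain ⟨-, l, a, hxl, rfl⟩ := Finset.mem_filter.1 hx
    obtain ⟨-, l', a', hyl, he⟩ := Finset.mem_filter.1 hy
    have h2 := finProdFinEquiv.injective (Fin.castLE_injective h he)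
    simp only [Prod.mk.injEq] at h2
    obtain ⟨rfl, rfl⟩ := h2
    have := H l' (hxl.trans hyl.symm)
    rw [hxl] at this
    exact absurd this (by simp)

lemma Choice.card (s : ℕ) : (Fintype.card (Choice s) : ℝ) = ((s : ℝ) + 1) ^ s := by
  simp [Choice]

-- In each block at most one of the `s + 1` values is forbidden, and `(s / (s + 1)) ^ s ≥ 1 / e ≥ 1
-- / 3`.
open scoped Classical in
lemma Choice.sum_disjoint_ge {s : ℕ} (hs : 1 ≤ s) (x : Choice s) :
    (Fintype.card (Choice s) : ℝ) / 3
      ≤ ∑ y : Choice s, if x.Avoids y then (1 : ℝ) else 0 := by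
  have h1 : ∑ y : Choice s, (if x.Avoids y then (1 : ℝ) else 0)
      = ((Fintype.piFinset fun l => Finset.univ.filter fun v => x l = v → x l = none).card : ℝ) := by
    rw [Finset.sum_boole]
    congr 2
    ext y
    rw [Finset.mem_filter, Fintype.mem_piFinset]
    simp only [Choice.Avoids, Finset.mem_filter, Finset.mem_univ, true_and]
  have h2 : ∀ l, s ≤ (Finset.univ.filter fun v => x l = v → x l = none).card := by
    intro l
    have : (Finset.univ.erase (x l)) ⊆ Finset.univ.filter fun v => x l = v → x l = none := by
      intro v hv
      refine Finset.mem_filter.2 ⟨Finset.mem_univ _, fun h => ?_⟩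
      exact absurd h.symm (Finset.ne_of_mem_erase hv)
    refine le_trans (le_of_eq ?_) (Finset.card_le_card this)
    rw [Finset.card_erase_of_mem (Finset.mem_univ _)]
    simp
  have h3 : s ^ s ≤ (Fintype.piFinset fun l =>
      Finset.univ.filter fun v => x l = v → x l = none).card := by
    rw [Fintype.card_piFinset]
    refine le_trans (le_of_eq ?_) (Finset.prod_le_prod' fun l _ => h2 l)
    simp
  rw [h1, Choice.card]
  have hs0 : (0 : ℝ) < s := by exact_mod_cast hs
  have h4 : ((s : ℝ) + 1) ^ s ≤ 3 * (s : ℝ) ^ s := by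
    have h5 : (s : ℝ) + 1 ≤ s * Real.exp (1 / s) := by
      have := mul_le_mul_of_nonneg_left (Real.add_one_le_exp (1 / (s : ℝ))) hs0.le
      rwa [mul_add, mul_one_div_cancel hs0.ne', mul_one, add_comm] at this
    calc ((s : ℝ) + 1) ^ s ≤ (s * Real.exp (1 / s)) ^ s :=
          pow_le_pow_left₀ (by positivity) h5 _
      _ = Real.exp 1 * (s : ℝ) ^ s := by
          rw [mul_pow, ← Real.exp_nat_mul, mul_one_div_cancel hs0.ne', mul_comm]
      _ ≤ 3 * (s : ℝ) ^ s := by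
          have := Real.exp_one_lt_d9
          gcongr
          linarith
  have h6 : (s : ℝ) ^ s ≤ ((Fintype.piFinset fun l =>
      Finset.univ.filter fun v => x l = v → x l = none).card : ℝ) := by exact_mod_cast h3
  linarith

end Encoding

/-! ### The averaging argument over queries and samples. -/

section Main

variable {n k s : ℕ}

lemma entropy_inf_ker_le {Ω : Type} [Fintype Ω] {p : Ω → ℝ} (hp : ∀ ω, 0 < p ω)
    (hs : ∑ ω, p ω = 1) {α : Type} (f : Ω → α) (M : Finset α) (hf : ∀ ω, f ω ∈ M) (C : Setoid Ω) :
    entropy p (C ⊓ Setoid.ker f) ≤ entropy p C + Real.log M.card :=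
  (entropy_inf_le hp hs _ _).trans (by have := entropy_ker_le_log_card hp hs f M hf; linarith)

open scoped Classical in
/-- The cost of one query, in terms of the mutual information of the inputs before the conversation
and of their entropy deficiencies. -/
lemma disjoint_information_bound {Ω : Type} [Fintype Ω] {p : Ω → ℝ} (hp : ∀ ω, 0 < p ω)
    (hsum : ∑ ω, p ω = 1) (hs : 1 ≤ s) {X Y : Type} (P : Ω → TwoParty X Y) (x : Ω → X) (y : Ω → Y)
    (a b : Ω → Choice s) {B C : Setoid Ω} (ha : Setoid.ker a ≤ Setoid.ker x) (hB : B ≤ Setoid.ker y)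
    (hBb : B ≤ Setoid.ker b) (hC : C ≤ Setoid.ker P) {r : ℕ}
    (hr : ∀ ω, ((P ω).transcript (x ω) (y ω)).length ≤ r)
    (hans : ∀ ω, (P ω).answer (x ω) (y ω) = true ↔ Choice.Avoids (a ω) (b ω)) :
    s * (∑ ω, if Choice.Avoids (a ω) (b ω) then p ω else 0) / 8
      ≤ (s + 3) * mutualInfo p (Setoid.ker a) B C
        + 2 * ((s * Real.log ((s : ℝ) + 1) - (entropy p (Setoid.ker a ⊓ C) - entropy p C))
          + (s * Real.log ((s : ℝ) + 1) - (entropy p (Setoid.ker b ⊓ C) - entropy p C))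
          + 2 * (r + 2)) := by
  -- The outcome includes the answer, so disjointness is constant on the classes of `F`.
  set F : Setoid Ω := C ⊓ Setoid.ker fun ω => (P ω).outcome (x ω) (y ω) with hF
  have h1 : mutualInfo p (Setoid.ker a) B F ≤ mutualInfo p (Setoid.ker a) B C :=
    TwoParty.mutualInfo_outcome_le hp hsum x y ha hB r C P hC hr
  have h2 := mutualInfo_mono_right hp hsum (Setoid.ker a) F hBb
  have h3 := mutualInfo_ge_of_disjoint hp hsum hs F a b
    (fun ω => Choice.Avoids (a ω) (b ω)) (fun ω ω' h => by
      have : (P ω).outcome (x ω) (y ω) = (P ω').outcome (x ω') (y ω') := h.2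
      rw [← hans, ← hans, show (P ω).answer (x ω) (y ω) = (P ω').answer (x ω') (y ω') from
        congrArg Prod.snd this]) (fun ω h => h)
  have hFC : entropy p F ≤ entropy p C + (r + 2) := by
    have h4 := entropy_inf_ker_le hp hsum (fun ω => (P ω).outcome (x ω) (y ω))
      (shortMessages r ×ˢ Finset.univ)
      (fun ω => Finset.mem_product.2 ⟨mem_shortMessages (hr ω), Finset.mem_univ _⟩) C
    rw [Finset.card_product, Finset.card_univ, Fintype.card_bool] at h4
    have h5 := log_card_shortMessages_le r
    have h6 : (0 : ℝ) < (shortMessages r).card := by exact_mod_cast card_shortMessages_pos r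
    have h7 := Real.log_two_lt_d9
    push_cast at h4
    rw [Real.log_mul h6.ne' two_ne_zero] at h4
    linarith
  have h4 : entropy p (Setoid.ker a ⊓ C) ≤ entropy p (Setoid.ker a ⊓ F) :=
    entropy_mono hp (inf_le_inf_left _ inf_le_left)
  have h5 : entropy p (Setoid.ker b ⊓ C) ≤ entropy p (Setoid.ker b ⊓ F) :=
    entropy_mono hp (inf_le_inf_left _ inf_le_left)
  -- The joint deficiency contains the mutual information once more; with its factor 2 this turns `s
  -- + 1` into `s + 3`.
  have h6 : entropy p (Setoid.ker a ⊓ Setoid.ker b ⊓ F)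
      = entropy p (Setoid.ker a ⊓ F) + entropy p (Setoid.ker b ⊓ F) - entropy p F
        - mutualInfo p (Setoid.ker a) (Setoid.ker b) F := by
    unfold mutualInfo
    ring
  have hN : (0 : ℝ) < (s : ℝ) + 1 := by positivity
  rw [one_div, inv_mul_le_iff₀ hN, h6] at h3
  have h7 : mutualInfo p (Setoid.ker a) (Setoid.ker b) F ≤ mutualInfo p (Setoid.ker a) B C :=
    h2.trans h1
  have h8 := mul_le_mul_of_nonneg_left h7 hN.le
  linarith

/-- On the right, the first term comes from the total entropy of the hint and all views of Bob, the
second from the messages, charged once per index. -/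
lemma ModifiedProtocol.large_cost (Γ : ModifiedProtocol n k) (hΓ : Γ.Solves) (hk : 1 ≤ k)
    (hs : 1 ≤ s) (hsn : s * s ≤ n) {r u : ℕ} (hu : ∀ S T, (Γ.advice S T).length ≤ u)
    (hr : ∀ S T i, Γ.cost S T i ≤ r) :
    (k : ℝ) * s / 24 ≤ 6 * (s * (s * Real.log ((s : ℝ) + 1) + (u + 1)) + (r + 1))
      + k * (12 * (r + 2)) := by
  classical
  have : NeZero s := ⟨by omega⟩
  set f : Choice s → Subset n := fun x => x.toSubset hsn with hf
  set hint : (Fin k → Choice s) → Choice s → Message := fun S T => Γ.hint (fun i => f (S i)) (f T)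
    with hhint
  set p := copiesProb (t := s) hint with hpdef
  have hp : ∀ ω, 0 < p ω := copiesProb_pos hint
  have hsum : ∑ ω, p ω = 1 := sum_copiesProb hint
  set g₀ : ℝ := s * Real.log ((s : ℝ) + 1) with hg₀
  have hg : Real.log (Fintype.card (Choice s)) = g₀ := by
    rw [Choice.card, Real.log_pow]
  have hs0 : (1 : ℝ) ≤ s := by exact_mod_cast hs
  have hk0 : (0 : ℝ) ≤ k := Nat.cast_nonneg k
  -- The random variables.
  set S : Copies hint s → Fin k → Choice s := fun ω => ω.1.1 with hS
  set T : Copies hint s → Fin s → Choice s := fun ω => ω.1.2 with hT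
  set U : Copies hint s → Fin s → Message :=
    fun ω j => Γ.advice (fun i => f (S ω i)) (f (T ω j)) with hU
  set Y : Copies hint s → Fin s → Choice s × Message := fun ω j => (T ω j, U ω j) with hY
  set U' : Copies hint s → Message := fun ω => hint (S ω) (T ω 0) with hU'
  set M : Fin k → Copies hint s → Message :=
    fun i ω => Γ.megan (fun i => f (S ω i)) i (U' ω) with hM
  set A : Fin k → Setoid (Copies hint s) := fun i => Setoid.ker fun ω => S ω i with hA
  set C₀ : Fin k → Setoid (Copies hint s) := fun i => Setoid.ker U' ⊓ Setoid.ker (M i) with hC₀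
  set W : Setoid (Copies hint s) := Setoid.ker U' ⊓ Setoid.ker Y with hW
  set Δ : Fin k → ℝ := fun i => g₀ - (entropy p (A i ⊓ W) - entropy p W) with hΔ
  -- The common hint makes Megan's message the same for every sample `j`.
  have hmeg : ∀ i ω j, M i ω = Γ.meganMessage (fun i => f (S ω i)) (f (T ω j)) i := by
    intro i ω j
    have : U' ω = Γ.hint (fun i => f (S ω i)) (f (T ω j)) := ω.2 0 j
    simp only [hM, ModifiedProtocol.meganMessage, this]
  have hU'r : ∀ S T, hint S T ∈ shortMessages r := fun S T => mem_shortMessages <| by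
    refine le_trans ?_ (hr (fun i => f (S i)) (f T) ⟨0, hk⟩)
    unfold ModifiedProtocol.cost
    simp only [hhint]
    omega
  set L : ℝ := Real.log (shortMessages r).card with hL
  have hLr : L ≤ r + 1 := log_card_shortMessages_le r
  have hUlog := log_card_shortMessages_le u
  have hMr : ∀ i ω, M i ω ∈ shortMessages r := fun i ω => mem_shortMessages <| by
    rw [hmeg i ω 0]
    refine le_trans ?_ (hr (fun i => f (S ω i)) (f (T ω 0)) i)
    unfold ModifiedProtocol.cost
    omega
  -- The entropy of everything that Bob and Megan learn.
  have hWle : entropy p W ≤ L + s * (g₀ + (u + 1)) := by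
    have h1 := entropy_ker_le_log_card hp hsum U' _ fun ω => hU'r (S ω) (T ω 0)
    have h2 := entropy_ker_le_log_card hp hsum Y
      (Fintype.piFinset fun _ => Finset.univ ×ˢ shortMessages u)
      (fun ω => Fintype.mem_piFinset.2 fun j => Finset.mem_product.2
        ⟨Finset.mem_univ _, mem_shortMessages (hu _ _)⟩)
    have h6 : (0 : ℝ) < (shortMessages u).card := by exact_mod_cast card_shortMessages_pos u
    have h7 : (0 : ℝ) < Fintype.card (Choice s) := by exact_mod_cast Fintype.card_pos
    rw [Fintype.card_piFinset] at h2
    simp only [Finset.card_product, Finset.prod_const, Finset.card_univ, Fintype.card_fin] at h2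
    push_cast at h2
    rw [Real.log_pow, Real.log_mul h7.ne' h6.ne', hg] at h2
    have h3 := entropy_inf_le hp hsum (Setoid.ker U') (Setoid.ker Y)
    have h4 := mul_le_mul_of_nonneg_left hUlog (by linarith : (0 : ℝ) ≤ s)
    linarith
  -- The joint entropy of the `S_i` is the full `k * g₀`; conditioning on `W` removes at most the
  -- entropy of `W`, and the chain rule distributes this loss over `i`.
  have hΔsum : ∑ i, Δ i ≤ entropy p W := by
    have h1 := sum_entropy_prefixKer (p := p) S W
    have h2 : ∀ i : Fin k, entropy p (Setoid.ker (fun ω => S ω i) ⊓ (W ⊓ prefixKer S i))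
        - entropy p (W ⊓ prefixKer S i) ≤ entropy p (A i ⊓ W) - entropy p W :=
      fun i => entropy_inf_sub_anti hp hsum _ inf_le_left
    have h3 := Finset.sum_le_sum fun i (_ : i ∈ Finset.univ) => h2 i
    rw [h1] at h3
    have h4 : entropy p (Setoid.ker S) ≤ entropy p (W ⊓ Setoid.ker S) :=
      entropy_mono hp inf_le_right
    have h5 : entropy p (Setoid.ker S) = k * g₀ := by
      rw [← hg]
      exact entropy_copies_fst hint
    simp only [hΔ]
    rw [Finset.sum_sub_distrib]
    simp only [Finset.sum_const, Finset.card_univ, Fintype.card_fin, nsmul_eq_mul]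
    linarith
  have hMW : ∀ i, g₀ - (entropy p (A i ⊓ (W ⊓ Setoid.ker (M i)))
      - entropy p (W ⊓ Setoid.ker (M i))) ≤ Δ i + L := by
    intro i
    have h1 := entropy_inf_ker_le hp hsum (M i) _ (hMr i) W
    have h2 : entropy p (A i ⊓ W) ≤ entropy p (A i ⊓ (W ⊓ Setoid.ker (M i))) :=
      entropy_mono hp (inf_le_inf_left _ inf_le_left)
    simp only [hΔ]
    linarith
  have hA₀ : ∀ i, entropy p (A i) ≤ g₀ := by
    intro i
    have := entropy_ker_le_log_card hp hsum (fun ω => S ω i) Finset.univ fun _ => Finset.mem_univ _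
    rwa [Finset.card_univ, hg] at this
  -- The gain from the copies: one bound, free of a factor `s`, covers the information in all `s`
  -- views.
  have hIsum : ∀ i, ∑ j, mutualInfo p (A i) (Setoid.ker fun ω => Y ω j) (C₀ i ⊓ prefixKer Y j)
      ≤ Δ i + L := by
    intro i
    rw [sum_mutualInfo_prefixKer]
    refine le_trans ?_ (hMW i)
    have h1 := entropy_inf_le hp hsum (A i) (C₀ i)
    have h2 := hA₀ i
    have h3 : W ⊓ Setoid.ker (M i) = Setoid.ker Y ⊓ C₀ i := by
      simp only [hW, hC₀]
      ac_rfl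
    rw [h3, ← inf_assoc]
    unfold mutualInfo
    linarith
  have hX : ∀ i (j : Fin s), g₀ - (entropy p (A i ⊓ (C₀ i ⊓ prefixKer Y j))
      - entropy p (C₀ i ⊓ prefixKer Y j)) ≤ Δ i + L := by
    intro i j
    refine le_trans (sub_le_sub_left (entropy_inf_sub_anti hp hsum (A i) ?_) _) (hMW i)
    rintro ω ω' ⟨⟨h1, h2⟩, h3⟩
    exact ⟨⟨h1, h3⟩, fun m _ => congrFun h2 m⟩
  -- `S`, the hint and the earlier samples determine Megan's message and the earlier advice, so
  -- conditioning on them is finer. Given `S` and the hint, the samples keep entropy at least `s *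
  -- g₀ - s * L`.
  have hTsum : ∀ i, ∑ j : Fin s, (g₀ - (entropy p (Setoid.ker (fun ω => T ω j)
      ⊓ (C₀ i ⊓ prefixKer Y j)) - entropy p (C₀ i ⊓ prefixKer Y j))) ≤ s * L := by
    intro i
    set V : Setoid (Copies hint s) := Setoid.ker S ⊓ Setoid.ker U' with hV
    have h1 := sum_entropy_prefixKer (p := p) T V
    have h2 : ∀ j : Fin s, entropy p (Setoid.ker (fun ω => T ω j) ⊓ (V ⊓ prefixKer T j))
        - entropy p (V ⊓ prefixKer T j) ≤ entropy p (Setoid.ker (fun ω => T ω j)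
          ⊓ (C₀ i ⊓ prefixKer Y j)) - entropy p (C₀ i ⊓ prefixKer Y j) := by
      intro j
      refine entropy_inf_sub_anti hp hsum _ ?_
      rintro ω ω' ⟨⟨h1, h2⟩, h3⟩
      have e1 : S ω = S ω' := h1
      have e2 : U' ω = U' ω' := h2
      refine ⟨⟨h2, ?_⟩, fun m hm => ?_⟩
      · change M i ω = M i ω'
        simp only [hM, e1, e2]
      · simp only [hY, hU, e1, h3 m hm]
    have h3 := Finset.sum_le_sum fun j (_ : j ∈ Finset.univ) => h2 j
    rw [h1] at h3
    have h4 : (k + s) * g₀ - (s - 1) * L ≤ entropy p (V ⊓ Setoid.ker T) := by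
      rw [← hg]
      refine entropy_copies_ge hint _ hU'r ?_
      rintro ω ω' ⟨⟨e1, -⟩, e2⟩
      exact Subtype.ext (Prod.ext e1 e2)
    have h5 : entropy p V ≤ k * g₀ + L := by
      have h6 : entropy p (Setoid.ker S) = k * g₀ := by
        rw [← hg]
        exact entropy_copies_fst hint
      rw [← h6]
      exact entropy_inf_ker_le hp hsum U' _ (fun ω => hU'r (S ω) (T ω 0)) _
    rw [Finset.sum_sub_distrib]
    simp only [Finset.sum_const, Finset.card_univ, Fintype.card_fin, nsmul_eq_mul]
    linarith
  -- One query.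
  have hquery : ∀ i (j : Fin s), (s : ℝ) / 24
      ≤ (s + 3) * mutualInfo p (A i) (Setoid.ker fun ω => Y ω j) (C₀ i ⊓ prefixKer Y j)
        + 2 * ((g₀ - (entropy p (A i ⊓ (C₀ i ⊓ prefixKer Y j)) - entropy p (C₀ i ⊓ prefixKer Y j)))
          + (g₀ - (entropy p (Setoid.ker (fun ω => T ω j) ⊓ (C₀ i ⊓ prefixKer Y j))
            - entropy p (C₀ i ⊓ prefixKer Y j)))
          + 2 * (r + 2)) := by
    intro i j
    have h1 := disjoint_information_bound hp hsum hs (fun ω => Γ.talk i (M i ω))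
      (fun ω => f (S ω i)) (fun ω => (f (T ω j), U ω j)) (fun ω => S ω i) (fun ω => T ω j)
      (B := Setoid.ker fun ω => Y ω j) (C := C₀ i ⊓ prefixKer Y j) (r := r)
      (fun ω ω' h => congrArg f h) (fun ω ω' h => by
        have e : Y ω j = Y ω' j := h
        change (f (Y ω j).1, (Y ω j).2) = (f (Y ω' j).1, (Y ω' j).2)
        rw [e]) (fun ω ω' h => congrArg Prod.fst h)
      (fun ω ω' h => congrArg (Γ.talk i) h.1.2) (fun ω => by
        refine le_trans ?_ (hr (fun i => f (S ω i)) (f (T ω j)) i)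
        rw [hmeg i ω j]
        exact Nat.le_add_left _ _) (fun ω => by
        rw [hmeg i ω j, ← Choice.disjoint_toSubset hsn]
        exact hΓ (fun i => f (S ω i)) (f (T ω j)) i)
    refine le_trans ?_ h1
    have h2 := sum_copiesProb_mul hint (t := s)
      (fun S g => if Choice.Avoids (S i) g then 1 else 0) j
    have h3 : (1 : ℝ) / 3
        ≤ ∑ ω, if Choice.Avoids (S ω i) (T ω j) then p ω else 0 := by
      have h7 : (0 : ℝ) < Fintype.card (Choice s) := by exact_mod_cast Fintype.card_pos
      simp only [mul_ite, mul_one, mul_zero] at h2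
      refine le_trans ?_ h2.ge
      rw [le_div_iff₀ (by positivity)]
      refine le_trans (le_of_eq ?_) (Finset.sum_le_sum fun S (_ : S ∈ Finset.univ) =>
        Choice.sum_disjoint_ge hs (S i))
      simp only [Finset.sum_const, Finset.card_univ, Fintype.card_pi, nsmul_eq_mul,
        Finset.prod_const, Fintype.card_fin, Nat.cast_pow]
      ring
    have := mul_le_mul_of_nonneg_left h3 (by linarith : (0 : ℝ) ≤ s)
    linarith
  have hrow : ∀ i, (s : ℝ) * s / 24 ≤ 6 * s * (Δ i + L) + 2 * s * L + 4 * s * (r + 2) := by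
    intro i
    have h1 := Finset.sum_le_sum fun j (_ : j ∈ Finset.univ) => hquery i j
    have h2 := Finset.sum_le_sum fun j (_ : j ∈ (Finset.univ : Finset (Fin s))) => hX i j
    have h3 := hTsum i
    have h4 := hIsum i
    have h5 : 0 ≤ Δ i + L := (Finset.sum_nonneg fun j _ =>
      mutualInfo_nonneg hp hsum _ _ _).trans h4
    rw [Finset.sum_add_distrib, ← Finset.mul_sum, ← Finset.mul_sum, Finset.sum_add_distrib,
      Finset.sum_add_distrib] at h1
    simp only [Finset.sum_const, Finset.card_univ, Fintype.card_fin, nsmul_eq_mul] at h1 h2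
    have h6 := mul_le_mul_of_nonneg_left h4 (by linarith : (0 : ℝ) ≤ s + 3)
    have h7 := mul_le_mul_of_nonneg_right (by linarith : (s : ℝ) + 3 ≤ 4 * s) h5
    linarith
  have hrow' : ∀ i, (s : ℝ) / 24 ≤ 6 * (Δ i + L) + 2 * L + 4 * (r + 2) := by
    intro i
    have h1 := hrow i
    have h2 : (s : ℝ) * (s / 24) ≤ s * (6 * (Δ i + L) + 2 * L + 4 * (r + 2)) := by linarith
    exact le_of_mul_le_mul_left h2 (by linarith)
  have htot := Finset.sum_le_sum fun i (_ : i ∈ Finset.univ) => hrow' i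
  rw [Finset.sum_add_distrib, Finset.sum_add_distrib, ← Finset.mul_sum, Finset.sum_add_distrib]
    at htot
  simp only [Finset.sum_const, Finset.card_univ, Fintype.card_fin, nsmul_eq_mul] at htot
  have hkL := mul_le_mul_of_nonneg_left hLr hk0
  linarith

end Main

/-! ### Small `n`, choice of constants, and 1.5-round protocols. -/

section Conclusion

variable {n k : ℕ}

/-- Without any communication except short advice the task cannot be solved. -/
lemma ModifiedProtocol.exists_cost_pos (Γ : ModifiedProtocol n k) (hΓ : Γ.Solves) (hn : 1 ≤ n)
    {u : ℕ} (hu : ∀ S T, (Γ.advice S T).length ≤ u) (huk : u + 1 ≤ k) :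
    ∃ S T i, 1 ≤ Γ.cost S T i := by
  classical
  by_contra! hcost
  have hne : (Finset.univ : Subset n) ≠ ∅ :=
    (Finset.univ_nonempty_iff.2 ⟨⟨0, hn⟩⟩).ne_empty
  have hm : ∀ S T i, Γ.meganMessage S T i = [] := by
    intro S T i
    have := hcost S T i
    unfold cost at this
    exact List.length_eq_zero_iff.1 (by omega)
  have ht : ∀ S T i, (Γ.talk i []).transcript (S i) (T, Γ.advice S T) = [] := by
    intro S T i
    have := hcost S T i
    unfold cost talkTranscript at this
    rw [hm] at this
    exact List.length_eq_zero_iff.1 (by omega)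
  have ha : ∀ S T i, (Γ.talk i []).answer (S i) (T, Γ.advice S T) = true ↔ Disjoint (S i) T := by
    intro S T i
    have := hΓ S T i
    unfold answer at this
    rwa [hm] at this
  have hbob : ∀ i, ∃ out : Subset n × Message → Bool,
      ∀ S T, out (T, Γ.advice S T) = true ↔ Disjoint (S i) T := by
    intro i
    cases h : Γ.talk i [] with
    | aliceAnswers out =>
      -- Alice cannot answer alone: she does not see whether `T` is empty or everything.
      have h1 := ha (fun _ => Finset.univ) ∅ i
      have h2 := ha (fun _ => Finset.univ) Finset.univ i
      rw [h] at h1 h2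
      have h3 := h2.1 (h1.2 (Finset.disjoint_empty_right _))
      exact absurd (disjoint_self.1 h3) hne
    | bobAnswers out =>
      refine ⟨out, fun S T => ?_⟩
      have h1 := ha S T i
      rwa [h] at h1
    | aliceSends bit next =>
      have h1 := ht (fun _ => ∅) ∅ i
      rw [h] at h1
      simp [TwoParty.transcript] at h1
    | bobSends bit next =>
      have h1 := ht (fun _ => ∅) ∅ i
      rw [h] at h1
      simp [TwoParty.transcript] at h1
  choose out hout using hbob
  -- With `T` everything, Bob recovers every bit of `b` from the advice. So `2 ^ k` families need
  -- distinct advice, but fewer than `2 ^ (u + 1)` strings are available.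
  set fam : (Fin k → Bool) → Family n k := fun b i => if b i then ∅ else Finset.univ with hfam
  have hinj : Function.Injective fun b => Γ.advice (fam b) Finset.univ := by
    intro b b' hbb
    have hbb' : Γ.advice (fam b) Finset.univ = Γ.advice (fam b') Finset.univ := hbb
    have key : ∀ (b : Fin k → Bool) i, Disjoint (fam b i) (Finset.univ : Subset n) ↔ b i = true := by
      intro b i
      by_cases hb : b i = true
      · simp [hfam, hb]
      · have h1 : fam b i = Finset.univ := by simp [hfam, hb]
        rw [h1, disjoint_self]
        exact ⟨fun h => absurd h hne, fun h => absurd h hb⟩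
    funext i
    have h1 := hout i (fam b) Finset.univ
    rw [hbb', hout i (fam b') Finset.univ, key, key] at h1
    exact Bool.eq_iff_iff.2 h1.symm
  have hcard := Finset.card_le_card_of_injOn (s := Finset.univ) (t := shortMessages u) _
    (fun b _ => mem_shortMessages (hu (fam b) Finset.univ)) hinj.injOn
  have h2 := card_shortMessages_lt u
  have h3 : 2 ^ (u + 1) ≤ 2 ^ k := Nat.pow_le_pow_right (by norm_num) huk
  simp only [Finset.card_univ, Fintype.card_pi, Fintype.card_bool, Finset.prod_const,
    Fintype.card_fin] at hcard
  omega

lemma ModifiedProtocol.exists_cost_ge (Γ : ModifiedProtocol n k) (hΓ : Γ.Solves) (hn : 1 ≤ n)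
    (hnk : (n : ℝ) ≤ 1 / 1000 * k)
    (hadv : ∀ S T, ((Γ.advice S T).length : ℝ) ≤ 1 / 1000 * k) :
    ∃ i S T, 1 / 4000 * Real.sqrt n ≤ (Γ.cost S T i : ℝ) := by
  by_contra! hcost
  have hn' : (1 : ℝ) ≤ n := by exact_mod_cast hn
  have hδk : (1 : ℝ) ≤ 1 / 1000 * k := hn'.trans hnk
  set u : ℕ := ⌊(1 / 1000 * k : ℝ)⌋₊ with hu
  have hu' : ∀ S T, (Γ.advice S T).length ≤ u := fun S T => Nat.le_floor (hadv S T)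
  have hule : (u : ℝ) ≤ 1 / 1000 * k := Nat.floor_le (by linarith)
  set s : ℕ := Nat.sqrt n with hs
  have hsn : s * s ≤ n := Nat.sqrt_le n
  have hs1 : 1 ≤ s := Nat.sqrt_pos.2 hn
  have hs1' : (1 : ℝ) ≤ s := by exact_mod_cast hs1
  have hsqrt : Real.sqrt n ≤ s + 1 := by
    rw [Real.sqrt_le_left (by positivity)]
    have : (n : ℝ) < ((s : ℝ) + 1) * (s + 1) := by exact_mod_cast Nat.lt_succ_sqrt n
    nlinarith
  -- In this range `√n ≤ s + 1 ≤ 4000`, so cost 1 suffices; otherwise `s ≥ 4000` absorbs the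
  -- additive constants.
  by_cases hsmall : s < 4000
  · have huk : u + 1 ≤ k := by
      have : (u : ℝ) + 1 ≤ k := by linarith
      exact_mod_cast this
    obtain ⟨S, T, i, h⟩ := Γ.exists_cost_pos hΓ hn hu' huk
    have h1 := hcost i S T
    have h2 : (1 : ℝ) ≤ Γ.cost S T i := by exact_mod_cast h
    have h3 : (s : ℝ) + 1 ≤ 4000 := by exact_mod_cast hsmall
    linarith
  · have hs2 : (4000 : ℝ) ≤ s := by exact_mod_cast not_lt.1 hsmall
    set r : ℕ := ⌊(1 / 4000 * Real.sqrt n : ℝ)⌋₊ with hr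
    have hr' : ∀ S T i, Γ.cost S T i ≤ r := fun S T i => Nat.le_floor (hcost i S T).le
    have hrle : (r : ℝ) ≤ 1 / 4000 * Real.sqrt n := Nat.floor_le (by positivity)
    have hk1 : (1 : ℝ) ≤ k := by linarith
    have hmain := Γ.large_cost hΓ (by exact_mod_cast hk1) hs1 hsn hu' hr'
    -- This is where `n ≤ δ k` pays for the entropy of one sample: `s log (s + 1) ≤ s² ≤ n`.
    have hlog : (s : ℝ) * Real.log ((s : ℝ) + 1) ≤ 1 / 1000 * k := by
      have h1 : Real.log ((s : ℝ) + 1) ≤ s := by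
        have := Real.log_le_sub_one_of_pos (show (0 : ℝ) < (s : ℝ) + 1 by positivity)
        linarith
      have h2 : (s : ℝ) * s ≤ n := by exact_mod_cast hsn
      have h3 := mul_le_mul_of_nonneg_left h1 (by linarith : (0 : ℝ) ≤ s)
      linarith
    have h1 : (s : ℝ) * (s * Real.log ((s : ℝ) + 1) + (u + 1)) ≤ s * (3 / 1000 * k) :=
      mul_le_mul_of_nonneg_left (by linarith) (by linarith)
    have h2 : (r : ℝ) + 2 ≤ s / 1000 := by linarith
    have h3 : (k : ℝ) * (r + 2) ≤ k * (s / 1000) := mul_le_mul_of_nonneg_left h2 (by linarith)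
    have h4 : (1 : ℝ) * s ≤ k * s := mul_le_mul_of_nonneg_right hk1 (by linarith)
    -- In units of `k * s`, the right side of `hmain` is at most `0.018 + 0.006 + 0.012 = 0.036 <
    -- 1/24`.
    linarith

/-- A 1.5-round protocol is a modified protocol in which Bob answers right after Megan's message. -/
def OneAndHalfRoundProtocol.toModified (Γ : OneAndHalfRoundProtocol n k) :
    ModifiedProtocol n k where
  advice := Γ.advice
  hint S T := Γ.forward T (Γ.advice S T)
  megan := Γ.alice
  talk i m := .bobAnswers fun y => Γ.output y.1 i y.2 m

end Conclusion

end Multiphase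

theorem mainTheorem6 :
    ∃ c δ : ℝ, 0 < c ∧ 0 < δ ∧
      ∀ n k : ℕ, 1 ≤ n → (n : ℝ) ≤ δ * (k : ℝ) →
        (∀ Γ : Multiphase.ModifiedProtocol n k, Γ.Solves →
          (∀ (S : Multiphase.Family n k) (T : Multiphase.Subset n),
            ((Γ.advice S T).length : ℝ) ≤ δ * (k : ℝ)) →
          ∃ (i : Fin k) (S : Multiphase.Family n k) (T : Multiphase.Subset n),
            c * Real.sqrt (n : ℝ) ≤ (Γ.cost S T i : ℝ)) ∧
        (∀ Γ : Multiphase.OneAndHalfRoundProtocol n k, Γ.Solves →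
          (∀ (S : Multiphase.Family n k) (T : Multiphase.Subset n),
            ((Γ.advice S T).length : ℝ) ≤ δ * (k : ℝ)) →
          ∃ (i : Fin k) (S : Multiphase.Family n k) (T : Multiphase.Subset n),
            c * Real.sqrt (n : ℝ) ≤ (Γ.cost S T i : ℝ)) := by
  refine ⟨1 / 4000, 1 / 1000, by norm_num, by norm_num, fun n k hn hnk =>
    ⟨fun Γ hΓ hadv => Γ.exists_cost_ge hΓ hn hnk hadv, fun Γ hΓ hadv => ?_⟩⟩
  -- Bob answers at once, so the conversation has length zero and cost, advice and correctness agree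
  -- definitionally.
  exact Γ.toModified.exists_cost_ge hΓ hn hnk hadv
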